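/- Let $P,X,Y,E$ be finite-dimensional Euclidean spaces with duals $P^*,X^*,Y^*,E^*$, $Z:=P\times X$, $g:Z\to Y$, $C\subset Y$, and $\Gamma(p):=\{x\in X\mid g(p,x)\in C\}$ for $p\in P$. Let $\bar z=(\bar p,\bar x)$ with $g(\bar z)\in C$. *Notation.* $\nabla f$ is the Fréchet derivative, $\nabla_p,\nabla_x$ are partial derivatives, and $A^*$ is the adjoint of $A$, acting between dual spaces. For a set $\Omega$ and $z\in\Omega$, the tangent cone is $$T_\Omega(z)=\{w\mid\exists\,t_k\downarrow0,\ w_k\to w:\ z+t_kw_k\in\Omega\ \text{for all }k\};$$ the regular normal cone $\widehat N_\Omega(z)$ is the set of dual vectors $z^*$ with $\limsup_{z'\to z,\,z'\in\Omega}\langle z^*,z'-z\rangle/\|z'-z\|\le0$; and $N_\Omega(z)$ is the limiting normal cone, i.e. the set of all limits of sequences $z_k^*\in\widehat N_\Omega(z_k)$ with $z_k\to z$, $z_k\in\Omega$. Put $N_\Omega(z)=\emptyset$ for $z\notin\Omega$. The critical cone is $\mathcal K_\Omega(z,z^*)=T_\Omega(z)\cap\{z^*\}^\perp$. Let $\Psi(p,x):=N_{\Gamma(p)}(x)\subset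 X^*$, and let the graphical derivative be $D\Psi(\bar p,\bar x,\bar x^*)(v)=\{u^*\mid(v,u^*)\in T_{\mathrm{gph}\,\Psi}(\bar p,\bar x,\bar x^*)\}$. Let $\pi_{X^*}:P^*\times X^*\to X^*$ be the projection $\pi_{X^*}(p^*,x^*)=x^*$, where $Z^*$ is identified with $P^*\times X^*$. *Assumptions.* 1. $g$ is $C^2$ around $\bar z$. 2. $C$ is closed and is $C^2$-reducible at $g(\bar z)$ to a closed convex cone $K\subset E$: there are a neighborhood $V$ of $g(\bar z)$ and a $C^2$ mapping $h:V\to E$ with $h(g(\bar z))=0$, $\nabla h(g(\bar z))$ surjective, and $C\cap V=\{y\in V\mid h(y)\in K\}$. 3. $\bar x^*\in N_{\Gamma(\bar p)}(\bar x)$. 4. (Robinson stability) There are $\kappa\ge0$ and neighborhoods $W$ of $\bar p$ and $U$ of $\bar x$ with $\mathrm{dist}(x;\Gamma(p))\le\kappa\,\mathrm{dist}(g(p,x);C)$ for all $(p,x)\in W\times U$, where $\mathrm{dist}(x;\emptyset)=\infty$. 5. Either $\mathcal P=P$, where with $G:=h\circ g$ and $\mathrm{lin}\,K:=K\cap(-K)$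 $$\mathcal P:=\{q\in P\mid\nabla_pG(\bar z)q\in\mathrm{rge}\,\nabla_xG(\bar z)+\mathrm{lin}\,K\},$$ or $K$ is polyhedral. *Multipliers and curvature.* For $\lambda\in N_C(g(\bar z))$ let $\mu_\lambda:=(\nabla h(g(\bar z))^*)^{-1}\lambda$ be the unique $\mu\in E^*$ with $\nabla h(g(\bar z))^*\mu=\lambda$, and for $v\in Z$ let $$\mathcal H_\lambda v:=\nabla_xg(\bar z)^*\,\nabla^2\langle\mu_\lambda,h(\cdot)\rangle(g(\bar z))\,\nabla g(\bar z)v\in X^*.$$ Let $\Lambda(\bar z,z^*):=\{\lambda\in N_C(g(\bar z))\mid\nabla g(\bar z)^*\lambda=z^*\}$, and let $\Lambda(\bar z,z^*;v)$ be the set of maximizers over $\lambda\in\Lambda(\bar z,z^*)$ of $$\langle\lambda,\nabla^2g(\bar z)(v,v)\rangle+\nabla^2\langle\mu_\lambda,h(\cdot)\rangle(g(\bar z))(\nabla g(\bar z)v,\nabla g(\bar z)v).$$ *Conclusion.* Under these assumptions, $$T_{\mathrm{gph}\,\Psi}(\bar p,\bar x,\bar x^*)=\Big\{(q,u,u^*)\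 \Big|\ \exists\,z^*\in N_{T_{\mathrm{gph}\,\Gamma}(\bar z)}(q,u)\cap\pi_{X^*}^{-1}(\bar x^*),\ \exists\,\hat\lambda\in\Lambda(\bar z,z^*;(q,u)):$$ $$u^*\in\big(\nabla(\nabla_xg(\cdot)^*\hat\lambda)(\bar z)+\mathcal H_{\hat\lambda}\big)(q,u)+\pi_{X^*}\big(N_{\mathcal K_{\mathrm{gph}\,\Gamma}(\bar z,z^*)}(q,u)\big)\Big\},$$ and consequently, for every $v\in Z$, $$D\Psi(\bar p,\bar x,\bar x^*)(v)=\bigcup_{z^*\in N_{T_{\mathrm{gph}\,\Gamma}(\bar z)}(v)\cap\pi_{X^*}^{-1}(\bar x^*)}\ \bigcup_{\hat\lambda\in\Lambda(\bar z,z^*;v)}\Big[\big(\nabla(\nabla_xg(\cdot)^*\hat\lambda)(\bar z)+\mathcal H_{\hat\lambda}\big)v+\pi_{X^*}\big(N_{\mathcal K_{\mathrm{gph}\,\Gamma}(\bar z,z^*)}(v)\big)\Big].$$ -/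

import Mathlib

open Filter Topology Set

noncomputable section

namespace VarAnalysis

section Cones

variable {Z W : Type*} [NormedAddCommGroup Z] [NormedSpace ℝ Z]
  [NormedAddCommGroup W] [NormedSpace ℝ W]

/-- The (Bouligand--Severi) tangent cone to `Ω` at `z₀`: all `w` for which there are
`t k ↓ 0` and `w k → w` with `z₀ + t k • w k ∈ Ω` for all `k`. -/
def tangentCone (Ω : Set Z) (z₀ : Z) : Set Z :=
  {w | ∃ (t : ℕ → ℝ) (wk : ℕ → Z), (∀ k, 0 < t k) ∧ Tendsto t atTop (𝓝 0) ∧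
    Tendsto wk atTop (𝓝 w) ∧ ∀ k, z₀ + t k • wk k ∈ Ω}

/-- The (Fréchet) regular normal cone to `Ω` at `z₀`, a set of dual vectors; it is empty at
points outside `Ω`. The second condition says that the upper limit of
`⟨z*, z - z₀⟩ / ‖z - z₀‖` as `z → z₀` in `Ω` is at most zero. -/
def regularNormalCone (Ω : Set Z) (z₀ : Z) : Set (StrongDual ℝ Z) :=
  {zs | z₀ ∈ Ω ∧ ∀ ε : ℝ, 0 < ε → ∀ᶠ z in 𝓝[Ω] z₀, zs (z - z₀) ≤ ε * ‖z - z₀‖}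

/-- The (Mordukhovich) limiting normal cone to `Ω` at `z₀`; it is empty at points outside `Ω`. -/
def normalCone (Ω : Set Z) (z₀ : Z) : Set (StrongDual ℝ Z) :=
  {zs | z₀ ∈ Ω ∧ ∃ (zk : ℕ → Z) (zsk : ℕ → StrongDual ℝ Z),
    (∀ k, zk k ∈ Ω ∧ zsk k ∈ regularNormalCone Ω (zk k)) ∧
    Tendsto zk atTop (𝓝 z₀) ∧ Tendsto zsk atTop (𝓝 zs)}

/-- The critical cone to `Ω` at `(z₀, zs)`: tangent vectors that `zs` annihilates. -/
def criticalCone (Ω : Set Z) (z₀ : Z) (zs : StrongDual ℝ Z) : Set Z :=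
  tangentCone Ω z₀ ∩ {w | zs w = 0}

/-- The graph of a set-valued mapping. -/
def gph (F : Z → Set W) : Set (Z × W) := {a | a.2 ∈ F a.1}

/-- The graphical derivative of the set-valued mapping `F` at `(z₀, w₀)`. -/
def graphicalDerivative (F : Z → Set W) (z₀ : Z) (w₀ : W) (v : Z) : Set W :=
  {w | (v, w) ∈ tangentCone (gph F) (z₀, w₀)}

end Cones

section System

variable {P X Y E : Type*}
  [NormedAddCommGroup P] [NormedSpace ℝ P] [NormedAddCommGroup X] [NormedSpace ℝ X]
  [NormedAddCommGroup Y] [NormedSpace ℝ Y] [NormedAddCommGroup E] [NormedSpace ℝ E]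

/-- The closed set `C` is `C²`-reducible at `y₀ ∈ C` to the closed convex cone `K` through the
mapping `h`, which matters only on a neighbourhood `V` of `y₀`. -/
structure IsC2ConeReduction (C : Set Y) (y₀ : Y) (h : Y → E) (K : ProperCone ℝ E) : Prop where
  isClosed : IsClosed C
  mem : y₀ ∈ C
  map_zero : h y₀ = 0
  surjective : Function.Surjective (fderiv ℝ h y₀)
  exists_nhd : ∃ V : Set Y, IsOpen V ∧ y₀ ∈ V ∧ ContDiffOn ℝ 2 h V ∧
    C ∩ V = {y ∈ V | h y ∈ K}

/-- The cone `K` is polyhedral: a finite intersection of homogeneous closed half-spaces. -/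
def IsPolyhedralCone (K : ProperCone ℝ E) : Prop :=
  ∃ s : Finset (StrongDual ℝ E), (K : Set E) = {y | ∀ φ ∈ s, φ y ≤ 0}

/-- The solution map `p ↦ {x | g (p, x) ∈ C}` of the constraint system `g (p, x) ∈ C`. -/
def solMap (g : P × X → Y) (C : Set Y) (p : P) : Set X := {x | g (p, x) ∈ C}

/-- The normal cone mapping `(p, x) ↦ N_{Γ(p)}(x)` of the solution map; its value is empty if
`x ∉ Γ(p)`. -/
def normalConeMap (g : P × X → Y) (C : Set Y) (z : P × X) : Set (StrongDual ℝ X) :=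
  normalCone (solMap g C z.1) z.2

/-- Robinson stability of `g (p, x) ∈ C` at `(p₀, x₀)`. Distances take values in `[0, ∞]`, so that
the distance to the empty set is infinite. -/
def RobinsonStable (g : P × X → Y) (C : Set Y) (p₀ : P) (x₀ : X) : Prop :=
  ∃ κ : NNReal, ∃ U ∈ 𝓝 x₀, ∃ W ∈ 𝓝 p₀, ∀ p ∈ W, ∀ x ∈ U,
    Metric.infEDist x (solMap g C p) ≤ (κ : ENNReal) * Metric.infEDist (g (p, x)) C

/-- The partial derivative `∇_p g (z)`. -/
def partialP (g : P × X → Y) (z : P × X) : P →L[ℝ] Y := fderiv ℝ (fun p => g (p, z.2)) z.1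

/-- The partial derivative `∇_x g (z)`. -/
def partialX (g : P × X → Y) (z : P × X) : X →L[ℝ] Y := fderiv ℝ (fun x => g (z.1, x)) z.2

/-- The characteristic subspace of the parameter space: all `q` such that `∇_p G(z₀) q` belongs
to `rge ∇_x G(z₀) + lin K`, where `G = h ∘ g` and `lin K` is the lineality space of `K`. -/
def characteristicSubspace (g : P × X → Y) (h : Y → E) (K : ProperCone ℝ E) (z₀ : P × X) :
    Submodule ℝ P :=
  (LinearMap.range (partialX (h ∘ g) z₀ : X →ₗ[ℝ] E) ⊔ K.toPointedCone.lineal).comap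
    (partialP (h ∘ g) z₀ : P →ₗ[ℝ] E)

/-- The projection `(p*, x*) ↦ x*` of the dual of `P × X` onto the dual of `X`. -/
def projX (zs : StrongDual ℝ (P × X)) : StrongDual ℝ X :=
  zs.comp (ContinuousLinearMap.inr ℝ P X)

/-- `(A*)⁻¹ lam`: the dual vector `μ` with `A* μ = μ ∘ A = lam`. It is unique if `A` is surjective,
and it exists if `lam` is in the range of the adjoint `A*`, the only case of interest. -/
def adjointInv (A : Y →L[ℝ] E) (lam : StrongDual ℝ Y) : StrongDual ℝ E :=
  Function.invFun (fun μ : StrongDual ℝ E => μ.comp A) lam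

/-- The second derivative at `y₀` of the function `⟨(∇h(y₀)*)⁻¹ lam, h(·)⟩`. -/
def reductionHessian (h : Y → E) (y₀ : Y) (lam : StrongDual ℝ Y) : Y →L[ℝ] Y →L[ℝ] ℝ :=
  fderiv ℝ (fderiv ℝ (fun y => adjointInv (fderiv ℝ h y₀) lam (h y))) y₀

/-- The multiplier set: all `lam ∈ N_C(g(z₀))` with `∇g(z₀)* lam = zs`. -/
def multipliers (g : P × X → Y) (C : Set Y) (z₀ : P × X) (zs : StrongDual ℝ (P × X)) :
    Set (StrongDual ℝ Y) :=
  {lam | lam ∈ normalCone C (g z₀) ∧ lam.comp (fderiv ℝ g z₀) = zs}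

/-- The function of `lam` maximized in the definition of directional multipliers. -/
def multiplierObjective (g : P × X → Y) (h : Y → E) (z₀ v : P × X) (lam : StrongDual ℝ Y) : ℝ :=
  lam (fderiv ℝ (fderiv ℝ g) z₀ v v) +
    reductionHessian h (g z₀) lam (fderiv ℝ g z₀ v) (fderiv ℝ g z₀ v)

/-- The directional multiplier set: the maximizers of `multiplierObjective` over `multipliers`. -/
def directionalMultipliers (g : P × X → Y) (C : Set Y) (h : Y → E) (z₀ : P × X)
    (zs : StrongDual ℝ (P × X)) (v : P × X) : Set (StrongDual ℝ Y) :=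
  {lam | lam ∈ multipliers g C z₀ zs ∧ ∀ lam' ∈ multipliers g C z₀ zs,
    multiplierObjective g h z₀ v lam' ≤ multiplierObjective g h z₀ v lam}

/-- The curvature term
`𝓗_lam v = ∇_x g(z₀)* ∇²⟨(∇h(g(z₀))*)⁻¹ lam, h(·)⟩(g(z₀)) ∇g(z₀) v`. -/
def curvatureTerm (g : P × X → Y) (h : Y → E) (z₀ : P × X) (lam : StrongDual ℝ Y) (v : P × X) :
    StrongDual ℝ X :=
  (reductionHessian h (g z₀) lam (fderiv ℝ g z₀ v)).comp (partialX g z₀)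

/-- The set `(∇(∇_x g(·)* lam)(z₀) + 𝓗_lam) v + π_{X*}(N_{𝒦}(v))`, where `𝒦` is the critical cone
to `gph Γ` at `(z₀, zs)`. -/
def derivativeSet (g : P × X → Y) (C : Set Y) (h : Y → E) (z₀ : P × X)
    (zs : StrongDual ℝ (P × X)) (lam : StrongDual ℝ Y) (v : P × X) : Set (StrongDual ℝ X) :=
  {us | ∃ ws ∈ normalCone (criticalCone (gph (solMap g C)) z₀ zs) v,
    us = fderiv ℝ (fun z => (lam.comp (partialX g z) : StrongDual ℝ X)) z₀ v +
      curvatureTerm g h z₀ lam v + projX ws}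

end System

end VarAnalysis

end

open VarAnalysis

/-!
Put `G = h ∘ g` and `A = ∇G(z₀)`. Near `z₀` the graph of the solution map is `{z | G z ∈ K}`, and
Robinson stability together with the metric regularity of `h` bounds the distance of `x` to the
section over `p` by a multiple of the distance of `G (p, x)` to `K` (`exists_isStableReduction`).
Conic duality, in the form of `exists_mem_polarCone_of_le_infDist`, turns this bound into a
multiplier rule: normals to the sections at nearby points are exactly the functionals
`ν ∘ ∇ₓG(z)` with `ν` in the polar of `K` and `ν (G z) = 0`, and `ν` can be chosen bounded by a
multiple of the normal. Translated to `G`, the claimed formula says that the tangent vectors to the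
graph of the normal cone mapping are those described by `IsReducedTangent`
(`exists_isReducedTangent_iff`).

Necessity: let `xs + t k • u k` be normals at `z₀ + t k • w k`, with multipliers `m k → μ`.
Expanding `m k ∘ ∇ₓG` shows that `(m k - μ) ∘ ∇ₓG(z₀) / t k` converges. This limit has to be lifted
from `X` to a normal of the critical cone in `P × X`. If the characteristic subspace is everything,
then `∇_p G` factors through `∇ₓG` modulo the lineality space of `K`, on which multipliers vanish, and
the convergence itself lifts (`exists_isReducedTangent_of_characteristic`). If `K` is polyhedral,
the Farkas lemma gives the lift (`exists_isReducedTangent_of_polyhedral`). The directional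
maximality of `μ` follows by comparing multipliers at the feasible points to second order.

Sufficiency: given a reduced tangent, minimize `-(zs + t • vs) (z - z₀)` plus a quadratic penalty
on `z - z₀ - t • v` over the graph of the solution map, near `z₀ + t • v`. Here `zs = μ ∘ A`, and
`vs = μ ∘ ∇²G(z₀) v + ws` is the desired derivative of the normals. The maximality of `μ` and
conic duality give recovery sequences (`exists_recovery`), which show that the minimizers are
`z₀ + t • (v + o(1))` (`eq_of_tendsto_minimizers`). The optimality condition at the minimizers then
gives normals to the graph with the derivative `vs`, and the multiplier rule turns their
`x`-components into normals to the sections (`exists_sequence_of_isReducedTangent`).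
-/

noncomputable section

namespace VarAnalysis

/-! ### Limits of continuous linear maps -/

section Limits

variable {α E F G : Type*} [NormedAddCommGroup E] [NormedSpace ℝ E] [NormedAddCommGroup F]
  [NormedSpace ℝ F] [NormedAddCommGroup G] [NormedSpace ℝ G] {l : Filter α}

lemma tendsto_clm_apply {f : α → E →L[ℝ] F} {f₀ : E →L[ℝ] F} {x : α → E} {x₀ : E}
    (hf : Tendsto f l (𝓝 f₀)) (hx : Tendsto x l (𝓝 x₀)) :
    Tendsto (fun a => f a (x a)) l (𝓝 (f₀ x₀)) :=
  (isBoundedBilinearMap_apply.continuous.tendsto (f₀, x₀)).comp (hf.prodMk_nhds hx)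

lemma tendsto_clm_comp {g : α → F →L[ℝ] G} {g₀ : F →L[ℝ] G} {f : α → E →L[ℝ] F} {f₀ : E →L[ℝ] F}
    (hg : Tendsto g l (𝓝 g₀)) (hf : Tendsto f l (𝓝 f₀)) :
    Tendsto (fun a => (g a).comp (f a)) l (𝓝 (g₀.comp f₀)) :=
  (isBoundedBilinearMap_comp.continuous.tendsto (g₀, f₀)).comp (hg.prodMk_nhds hf)

end Limits

/-! ### Polar cones and duality -/

section Duality

variable {E W : Type*} [NormedAddCommGroup E] [InnerProductSpace ℝ E]
  [NormedAddCommGroup W] [NormedSpace ℝ W]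

/-- The polar cone of `K`: the functionals that are nonpositive on `K`. -/
def polarCone (K : ProperCone ℝ E) : Set (StrongDual ℝ E) := {ν | ∀ y ∈ K, ν y ≤ 0}

lemma isClosed_polarCone (K : ProperCone ℝ E) : IsClosed (polarCone K) := by
  have : polarCone K = ⋂ y ∈ K, {ν : StrongDual ℝ E | ν y ≤ 0} := by
    ext ν; simp [polarCone]
  rw [this]
  refine isClosed_biInter fun y _ => isClosed_le ?_ continuous_const
  exact (ContinuousLinearMap.apply ℝ ℝ y).continuous

lemma convex_polarCone (K : ProperCone ℝ E) : Convex ℝ (polarCone K) := by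
  intro ν hν ν' hν' a b ha hb _ y hy
  have h1 := mul_nonpos_of_nonneg_of_nonpos ha (hν y hy)
  have h2 := mul_nonpos_of_nonneg_of_nonpos hb (hν' y hy)
  simpa using add_nonpos h1 h2

/-- The distance to a closed convex cone is a maximum of functionals in the polar cone; the
functional is a multiple of the residual of the metric projection. -/
lemma exists_mem_polarCone_apply_eq [FiniteDimensional ℝ E] (K : ProperCone ℝ E) {L : ℝ}
    (hL : 0 ≤ L) (y : E) :
    ∃ ν ∈ polarCone K, ‖ν‖ ≤ L ∧ ν y = L * Metric.infDist y K := by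
  obtain ⟨k, hk, hd⟩ := K.isClosed.exists_infDist_eq_dist K.nonempty y
  have hinf : ‖y - k‖ = ⨅ w : (K : Set E), ‖y - w‖ := by
    rw [← dist_eq_norm, ← hd, Metric.infDist_eq_iInf]
    simp [dist_eq_norm]
  have hproj := (norm_eq_iInf_iff_real_inner_le_zero K.convex hk).1 hinf
  have h0 : inner ℝ (y - k) k = 0 := by
    have h1 := hproj 0 K.zero_mem
    have h2 := hproj ((2 : ℝ) • k) (K.smul_mem hk (by norm_num))
    rw [two_smul, add_sub_cancel_right] at h2
    rw [zero_sub, inner_neg_right] at h1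
    linarith
  refine ⟨(L / ‖y - k‖) • innerSL ℝ (y - k), fun w hw => ?_, ?_, ?_⟩
  · have h1 := hproj w hw
    rw [inner_sub_right, h0, sub_zero] at h1
    exact mul_nonpos_of_nonneg_of_nonpos (div_nonneg hL (norm_nonneg _)) h1
  · rw [norm_smul, innerSL_apply_norm, Real.norm_of_nonneg (div_nonneg hL (norm_nonneg _))]
    by_cases hz : ‖y - k‖ = 0
    · simpa [hz] using hL
    · rw [div_mul_cancel₀ _ hz]
  · have h1 : inner ℝ (y - k) y = ‖y - k‖ * ‖y - k‖ := by
      rw [← real_inner_self_eq_norm_mul_norm, inner_sub_right (y - k) y k, h0, sub_zero]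
    simp only [smul_apply, innerSL_apply_apply, smul_eq_mul, h1, hd,
      dist_eq_norm]
    by_cases hz : ‖y - k‖ = 0
    · simp [hz]
    · field_simp

/-- Every functional on the dual of a finite-dimensional space is an evaluation. -/
lemma exists_eq_eval [FiniteDimensional ℝ W] (f : StrongDual ℝ W →ₗ[ℝ] ℝ) :
    ∃ w : W, ∀ θ : StrongDual ℝ W, f θ = θ w := by
  let e : Module.Dual ℝ W ≃ₗ[ℝ] StrongDual ℝ W := LinearMap.toContinuousLinearMap
  obtain ⟨w, hw⟩ := (Module.evalEquiv ℝ W).surjective (f ∘ₗ e.toLinearMap)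
  refine ⟨w, fun θ => ?_⟩
  have h1 := congrArg (fun F => F (e.symm θ)) hw
  have h2 : f (e (e.symm θ)) = (e.symm θ) w := h1.symm
  rwa [e.apply_symm_apply] at h2

/-- Conic duality with a bound on the multiplier: the inequality for all `w` is the infeasibility
of the strict system, and the alternative is obtained by separating the compact image of the
truncated polar cone from a ray. -/
theorem exists_mem_polarCone_of_le_infDist [FiniteDimensional ℝ W] [FiniteDimensional ℝ E]
    (K : ProperCone ℝ E) (B : W →L[ℝ] E) (b : E) {c L : ℝ} (hL : 0 ≤ L) (ws : StrongDual ℝ W)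
    (h : ∀ w, ws w + c ≤ L * Metric.infDist (B w + b) K) :
    ∃ ν ∈ polarCone K, ‖ν‖ ≤ L ∧ ν.comp B = ws ∧ c ≤ ν b := by
  by_contra hcon
  push Not at hcon
  let Φ : StrongDual ℝ E →L[ℝ] StrongDual ℝ W × ℝ :=
    (ContinuousLinearMap.precomp ℝ B).prod (ContinuousLinearMap.apply ℝ ℝ b)
  let D : Set (StrongDual ℝ E) := polarCone K ∩ Metric.closedBall 0 L
  have hDc : IsCompact D := (isCompact_closedBall 0 L).inter_left (isClosed_polarCone K)
  have hDconv : Convex ℝ D := (convex_polarCone K).inter (convex_closedBall 0 L)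
  have hdisj : Disjoint (Φ '' D) (({ws} : Set (StrongDual ℝ W)) ×ˢ Ici c) := by
    rw [Set.disjoint_left]
    rintro _ ⟨ν, ⟨hν, hνL⟩, rfl⟩ ⟨h1, h2⟩
    exact absurd h2 (not_le.2 (hcon ν hν (by simpa using hνL) h1))
  obtain ⟨f, u, r, hf1, hur, hf2⟩ := geometric_hahn_banach_compact_closed
    (hDconv.linear_image Φ.toLinearMap) (hDc.image Φ.continuous)
    ((convex_singleton ws).prod (convex_Ici c)) (isClosed_singleton.prod isClosed_Ici) hdisj
  obtain ⟨w, hw⟩ := exists_eq_eval (f.toLinearMap ∘ₗ LinearMap.inl ℝ (StrongDual ℝ W) ℝ)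
  set s : ℝ := f (0, 1) with hs
  have hf : ∀ (θ : StrongDual ℝ W) (a : ℝ), f (θ, a) = θ w + a * s := by
    intro θ a
    have h1 := hw θ
    have h2 : ((θ, a) : StrongDual ℝ W × ℝ) = (θ, 0) + a • (0, 1) := by simp
    rw [h2, map_add, map_smul, smul_eq_mul, ← hs]
    simpa using h1
  have hQ : ∀ ν ∈ D, ν (B w) + ν b * s < u := by
    intro ν hν
    have := hf1 _ (mem_image_of_mem Φ hν)
    simpa [Φ, hf] using this
  have hR : ∀ a, c ≤ a → r < ws w + a * s := by
    intro a ha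
    have := hf2 (ws, a) ⟨rfl, ha⟩
    rwa [hf] at this
  have hs0 : 0 ≤ s := by
    by_contra hneg
    push Not at hneg
    have h1 := hR (max c ((r - ws w) / s)) (le_max_left _ _)
    have h2 : max c ((r - ws w) / s) * s ≤ (r - ws w) / s * s :=
      mul_le_mul_of_nonpos_right (le_max_right _ _) hneg.le
    rw [div_mul_cancel₀ _ hneg.ne] at h2
    linarith
  -- A small increase of `s` keeps the separation strict and makes the coefficient positive.
  obtain ⟨s', hs', hsep⟩ : ∃ s' : ℝ, 0 < s' ∧ ∀ ν ∈ D, ν (B w) + ν b * s' < ws w + c * s' := by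
    have hbd : ∀ ν ∈ D, |ν b| ≤ L * ‖b‖ := fun ν hν =>
      (ν.le_opNorm b).trans (mul_le_mul_of_nonneg_right (by simpa using hν.2) (norm_nonneg _))
    set M := L * ‖b‖ + |c| + 1 with hM
    have hMpos : 0 < M := by positivity
    refine ⟨s + (r - u) / M, by have := div_pos (sub_pos.2 hur) hMpos; linarith,
      fun ν hν => ?_⟩
    have h1 := hQ ν hν
    have h2 := hR c le_rfl
    have h3 : (ν b - c) * ((r - u) / M) ≤ M * ((r - u) / M) := by
      refine mul_le_mul_of_nonneg_right ?_ (div_pos (sub_pos.2 hur) hMpos).le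
      have := le_abs_self (ν b)
      have := neg_abs_le c
      have := hbd ν hν
      linarith
    rw [mul_div_cancel₀ _ hMpos.ne'] at h3
    nlinarith
  obtain ⟨ν, hν, hνL, hνy⟩ := exists_mem_polarCone_apply_eq K hL (B (s'⁻¹ • w) + b)
  have h1 := hsep ν ⟨hν, by simpa using hνL⟩
  have h2 := h (s'⁻¹ • w)
  rw [← hνy, map_add, map_smul, map_smul, map_smul, smul_eq_mul, smul_eq_mul] at h2
  have h3 := mul_le_mul_of_nonneg_left h2 hs'.le
  have e1 : s' * (s'⁻¹ * ws w + c) = ws w + c * s' := by field_simp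
  have e2 : s' * (s'⁻¹ * ν (B w) + ν b) = ν (B w) + ν b * s' := by field_simp
  rw [e1, e2] at h3
  linarith

lemma infDist_add_le [FiniteDimensional ℝ E] (K : ProperCone ℝ E) (y : E) {k : E} (hk : k ∈ K) :
    Metric.infDist (k + y) K ≤ Metric.infDist y K := by
  obtain ⟨l, hl, hd⟩ := K.isClosed.exists_infDist_eq_dist K.nonempty y
  rw [hd]
  refine (Metric.infDist_le_dist_of_mem (K.add_mem hk hl)).trans_eq ?_
  simp

lemma infDist_smul_le [FiniteDimensional ℝ E] (K : ProperCone ℝ E) (y : E) {s : ℝ} (hs : 0 ≤ s) :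
    Metric.infDist (s • y) K ≤ s * Metric.infDist y K := by
  obtain ⟨l, hl, hd⟩ := K.isClosed.exists_infDist_eq_dist K.nonempty y
  rw [hd]
  refine (Metric.infDist_le_dist_of_mem (K.smul_mem hl hs)).trans_eq ?_
  rw [dist_smul₀, Real.norm_of_nonneg hs]

lemma infDist_le_add_norm_sub (K : ProperCone ℝ E) (y y' : E) :
    Metric.infDist y K ≤ Metric.infDist y' K + ‖y - y'‖ := by
  rw [← dist_eq_norm]
  exact Metric.infDist_le_infDist_add_dist

end Duality

/-! ### Normal cones and multipliers -/

section Normals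

variable {E W : Type*} [NormedAddCommGroup E] [InnerProductSpace ℝ E]
  [NormedAddCommGroup W] [NormedSpace ℝ W]

lemma regularNormalCone_subset_normalCone (Ω : Set W) (x : W) :
    regularNormalCone Ω x ⊆ normalCone Ω x := fun xs hxs =>
  ⟨hxs.1, fun _ => x, fun _ => xs, fun _ => ⟨hxs.1, hxs⟩, tendsto_const_nhds, tendsto_const_nhds⟩

/-- Multiplier rule for regular normals under a local error bound. -/
theorem exists_multiplier_of_mem_regularNormalCone [FiniteDimensional ℝ W]
    [FiniteDimensional ℝ E] {K : ProperCone ℝ E}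
    {F : W → E} {F' : W →L[ℝ] E} {Ω : Set W} {x : W} {κ : ℝ} (hκ : 0 ≤ κ)
    (hF : HasFDerivAt F F' x) (hFx : F x ∈ K)
    (hreg : ∀ᶠ x' in 𝓝 x, ∃ x'' ∈ Ω, ‖x'' - x'‖ ≤ κ * Metric.infDist (F x') K)
    {xs : StrongDual ℝ W} (hxs : xs ∈ regularNormalCone Ω x) :
    ∃ ν ∈ polarCone K, ‖ν‖ ≤ κ * ‖xs‖ ∧ ν.comp F' = xs ∧ ν (F x) = 0 := by
  suffices H : ∀ w, xs w + 0 ≤ κ * ‖xs‖ * Metric.infDist (F' w + F x) K by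
    obtain ⟨ν, hν, h1, h2, h3⟩ := exists_mem_polarCone_of_le_infDist K F' (F x)
      (mul_nonneg hκ (norm_nonneg xs)) xs H
    exact ⟨ν, hν, h1, h2, le_antisymm (hν _ hFx) h3⟩
  intro w
  rw [add_zero]
  set d := Metric.infDist (F' w + F x) K with hd
  have hd0 : 0 ≤ d := Metric.infDist_nonneg
  -- It suffices to prove the inequality up to an error that vanishes with `ε`.
  have key : ∀ ε : ℝ, 0 < ε → xs w ≤ ε * (‖w‖ + κ * (d + ε)) + ‖xs‖ * (κ * (d + ε)) := by
    intro ε hε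
    have hx := hxs.2 ε hε
    rw [eventually_nhdsWithin_iff, Metric.eventually_nhds_iff] at hx
    obtain ⟨δ, hδ, hx⟩ := hx
    have hc : Tendsto (fun t : ℝ => x + t • w) (𝓝[>] 0) (𝓝 x) := by
      have : Tendsto (fun t : ℝ => x + t • w) (𝓝 0) (𝓝 (x + (0 : ℝ) • w)) :=
        Continuous.tendsto (by fun_prop) _
      rw [zero_smul, add_zero] at this
      exact this.mono_left nhdsWithin_le_nhds
    have hder : ∀ᶠ t in 𝓝[>] (0 : ℝ), ‖F (x + t • w) - F x - t • F' w‖ ≤ ε * t := by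
      have h1 := (hF.isLittleO.comp_tendsto hc).bound
        (show 0 < ε / (‖w‖ + 1) by positivity)
      filter_upwards [h1, self_mem_nhdsWithin] with t ht htpos
      have htpos : 0 < t := htpos
      simp only [Function.comp, add_sub_cancel_left, map_smul, norm_smul,
        Real.norm_of_nonneg htpos.le] at ht
      refine ht.trans ?_
      rw [div_mul_eq_mul_div, div_le_iff₀ (by positivity)]
      nlinarith [norm_nonneg w, mul_pos hε htpos]
    have hsmall : ∀ᶠ t in 𝓝[>] (0 : ℝ), t * (‖w‖ + κ * (d + ε)) < δ := by
      have : Tendsto (fun t : ℝ => t * (‖w‖ + κ * (d + ε))) (𝓝 0)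
          (𝓝 (0 * (‖w‖ + κ * (d + ε)))) := Continuous.tendsto (by fun_prop) _
      rw [zero_mul] at this
      exact (this.mono_left nhdsWithin_le_nhds).eventually (gt_mem_nhds hδ)
    have hle1 : ∀ᶠ t in 𝓝[>] (0 : ℝ), t < 1 :=
      (tendsto_id.mono_left nhdsWithin_le_nhds).eventually (gt_mem_nhds one_pos)
    obtain ⟨t, hreg, hder, hsmall, hle1, htpos⟩ :=
      ((hc.eventually hreg).and (hder.and (hsmall.and (hle1.and self_mem_nhdsWithin)))).exists
    have htpos : 0 < t := htpos
    obtain ⟨x'', hx''Ω, hx''⟩ := hreg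
    have hdist : Metric.infDist (F (x + t • w)) K ≤ t * (d + ε) := by
      calc Metric.infDist (F (x + t • w)) K
          ≤ Metric.infDist (F x + t • F' w) K + ‖F (x + t • w) - (F x + t • F' w)‖ :=
            infDist_le_add_norm_sub K _ _
        _ ≤ t * d + ε * t := by
            refine add_le_add ?_ (by rwa [← sub_sub])
            have e : F x + t • F' w = (1 - t) • F x + t • (F' w + F x) := by module
            rw [e]
            exact (infDist_add_le K _ (K.smul_mem hFx (by linarith))).trans
              (infDist_smul_le K _ htpos.le)
        _ = t * (d + ε) := by ring
    have hnear : ‖x'' - (x + t • w)‖ ≤ t * (κ * (d + ε)) := by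
      refine hx''.trans ((mul_le_mul_of_nonneg_left hdist hκ).trans_eq (by ring))
    have hnear' : ‖x'' - x‖ ≤ t * (‖w‖ + κ * (d + ε)) := by
      have e : x'' - x = (x'' - (x + t • w)) + t • w := by module
      rw [e]
      refine (norm_add_le _ _).trans ?_
      rw [norm_smul, Real.norm_of_nonneg htpos.le]
      linarith
    have h1 := hx (y := x'') (by rw [dist_eq_norm]; linarith) hx''Ω
    have h2 : xs (t • w) = xs (x'' - x) - xs (x'' - (x + t • w)) := by
      rw [← map_sub]; congr 1; module
    have h3 : -xs (x'' - (x + t • w)) ≤ ‖xs‖ * ‖x'' - (x + t • w)‖ :=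
      (neg_le_abs _).trans (xs.le_opNorm _)
    rw [map_smul, smul_eq_mul] at h2
    have h4 := mul_le_mul_of_nonneg_left hnear' hε.le
    have h5 := mul_le_mul_of_nonneg_left hnear (norm_nonneg xs)
    have h6 : t * xs w ≤ t * (ε * (‖w‖ + κ * (d + ε)) + ‖xs‖ * (κ * (d + ε))) := by linarith
    exact le_of_mul_le_mul_left h6 htpos
  have hlim : Tendsto (fun ε : ℝ => ε * (‖w‖ + κ * (d + ε)) + ‖xs‖ * (κ * (d + ε))) (𝓝[>] 0)
      (𝓝 (0 * (‖w‖ + κ * (d + 0)) + ‖xs‖ * (κ * (d + 0)))) :=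
    Tendsto.mono_left (Continuous.tendsto (by fun_prop) _) nhdsWithin_le_nhds
  have := ge_of_tendsto hlim (by filter_upwards [self_mem_nhdsWithin] with ε hε using key ε hε)
  linarith

/-- Multiplier rule for limiting normals: the multipliers of the approximating regular normals
are bounded, and a cluster point of them is a multiplier. -/
theorem exists_multiplier_of_mem_normalCone [FiniteDimensional ℝ W]
    [FiniteDimensional ℝ E] {K : ProperCone ℝ E}
    {F : W → E} {Ω U : Set W} {x : W} {κ : ℝ} (hκ : 0 ≤ κ) (hU : IsOpen U) (hxU : x ∈ U)
    (hF : DifferentiableOn ℝ F U) (hF' : ContinuousOn (fderiv ℝ F) U)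
    (hΩ : ∀ x ∈ U, x ∈ Ω → F x ∈ K)
    (hreg : ∀ x' ∈ U, ∃ x'' ∈ Ω, ‖x'' - x'‖ ≤ κ * Metric.infDist (F x') K)
    {xs : StrongDual ℝ W} (hxs : xs ∈ normalCone Ω x) :
    ∃ ν ∈ polarCone K, ‖ν‖ ≤ κ * ‖xs‖ ∧ ν.comp (fderiv ℝ F x) = xs ∧ ν (F x) = 0 := by
  obtain ⟨hx, xk, xsk, hk, hxk, hxsk⟩ := hxs
  have hev : ∀ᶠ k in atTop, xk k ∈ U := hxk.eventually (hU.mem_nhds hxU)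
  have hmult : ∀ k, ∃ ν : StrongDual ℝ E, xk k ∈ U → ν ∈ polarCone K ∧ ‖ν‖ ≤ κ * ‖xsk k‖ ∧
      ν.comp (fderiv ℝ F (xk k)) = xsk k ∧ ν (F (xk k)) = 0 := by
    intro k
    by_cases hkU : xk k ∈ U
    · obtain ⟨ν, h⟩ := exists_multiplier_of_mem_regularNormalCone hκ
        (hF.differentiableAt (hU.mem_nhds hkU)).hasFDerivAt (hΩ _ hkU (hk k).1)
        (by filter_upwards [hU.mem_nhds hkU] with x' hx' using hreg x' hx') (hk k).2
      exact ⟨ν, fun _ => h⟩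
    · exact ⟨0, fun h => absurd h hkU⟩
  choose ν hν using hmult
  obtain ⟨M, hM⟩ := hxsk.norm.bddAbove_range
  have hb : ∃ᶠ k in atTop, ν k ∈ Metric.closedBall (0 : StrongDual ℝ E) (κ * M) := by
    refine Eventually.frequently ?_
    filter_upwards [hev] with k hkU
    rw [mem_closedBall_zero_iff]
    exact (hν k hkU).2.1.trans (mul_le_mul_of_nonneg_left (hM ⟨k, rfl⟩) hκ)
  obtain ⟨ν₀, -, φ, hφ, hlim⟩ := tendsto_subseq_of_frequently_bounded
    Metric.isBounded_closedBall hb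
  have hev' := hφ.tendsto_atTop.eventually hev
  have hxk' := hxk.comp hφ.tendsto_atTop
  have hxsk' := hxsk.comp hφ.tendsto_atTop
  have hcF : Tendsto (fun k => F (xk (φ k))) atTop (𝓝 (F x)) :=
    (hF.continuousOn.continuousAt (hU.mem_nhds hxU)).tendsto.comp hxk'
  have hcF' : Tendsto (fun k => fderiv ℝ F (xk (φ k))) atTop (𝓝 (fderiv ℝ F x)) :=
    (hF'.continuousAt (hU.mem_nhds hxU)).tendsto.comp hxk'
  refine ⟨ν₀, ?_, ?_, ?_, ?_⟩
  · exact (isClosed_polarCone K).mem_of_tendsto hlim (hev'.mono fun k hk => (hν _ hk).1)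
  · exact le_of_tendsto_of_tendsto hlim.norm (hxsk'.norm.const_mul κ)
      (hev'.mono fun k hk => (hν _ hk).2.1)
  · refine tendsto_nhds_unique ((tendsto_clm_comp hlim hcF')) (hxsk'.congr' ?_)
    filter_upwards [hev'] with k hk using (hν _ hk).2.2.1.symm
  · refine tendsto_nhds_unique (tendsto_clm_apply hlim hcF) (tendsto_const_nhds.congr' ?_)
    filter_upwards [hev'] with k hk using (hν _ hk).2.2.2.symm

/-- Multipliers generate regular normals; no constraint qualification is needed. -/
theorem comp_mem_regularNormalCone {K : ProperCone ℝ E} {F : W → E} {F' : W →L[ℝ] E} {Ω : Set W}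
    {x : W} (hF : HasFDerivAt F F' x) (hx : x ∈ Ω) (hΩ : ∀ᶠ x' in 𝓝 x, x' ∈ Ω → F x' ∈ K)
    {ν : StrongDual ℝ E} (hν : ν ∈ polarCone K) (hνx : ν (F x) = 0) :
    ν.comp F' ∈ regularNormalCone Ω x := by
  refine ⟨hx, fun ε hε => ?_⟩
  have h1 := (ν.hasFDerivAt.comp x hF).isLittleO.bound hε
  rw [eventually_nhdsWithin_iff]
  filter_upwards [h1, hΩ] with x' h1 h2 hx'
  have h3 := hν _ (h2 hx')
  have h4 := (neg_le_abs _).trans h1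
  simp only [Function.comp, hνx] at h4
  linarith

/-- For convex sets the limiting normal cone is the normal cone of convex analysis. -/
lemma mem_normalCone_of_convex {T : Set W} (hT : Convex ℝ T) {v : W} {zs : StrongDual ℝ W} :
    zs ∈ normalCone T v ↔ v ∈ T ∧ ∀ w ∈ T, zs (w - v) ≤ 0 := by
  constructor
  · rintro ⟨hv, zk, zsk, hk, hzk, hzsk⟩
    refine ⟨hv, fun w hw => ?_⟩
    have : ∀ k, zsk k (w - zk k) ≤ 0 := by
      intro k
      obtain ⟨hkT, -, hk⟩ := hk k
      have key : ∀ ε : ℝ, 0 < ε → zsk k (w - zk k) ≤ ε * ‖w - zk k‖ := by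
        intro ε hε
        have hc : Tendsto (fun t : ℝ => zk k + t • (w - zk k)) (𝓝[>] 0) (𝓝[T] (zk k)) := by
          refine tendsto_nhdsWithin_iff.2 ⟨?_, ?_⟩
          · have : Tendsto (fun t : ℝ => zk k + t • (w - zk k)) (𝓝 0)
                (𝓝 (zk k + (0 : ℝ) • (w - zk k))) := Continuous.tendsto (by fun_prop) _
            rw [zero_smul, add_zero] at this
            exact this.mono_left nhdsWithin_le_nhds
          · filter_upwards [Ioc_mem_nhdsGT (zero_lt_one (α := ℝ))] with t ht
            exact hT.add_smul_sub_mem hkT hw ⟨ht.1.le, ht.2⟩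
        obtain ⟨t, h1, ht⟩ := ((hc.eventually (hk ε hε)).and self_mem_nhdsWithin).exists
        have ht : 0 < t := ht
        rw [add_sub_cancel_left, map_smul, norm_smul, Real.norm_of_nonneg ht.le, smul_eq_mul] at h1
        exact le_of_mul_le_mul_left (h1.trans_eq (by ring)) ht
      have hlim : Tendsto (fun ε : ℝ => ε * ‖w - zk k‖) (𝓝[>] 0) (𝓝 (0 * ‖w - zk k‖)) :=
        Tendsto.mono_left (Continuous.tendsto (by fun_prop) _) nhdsWithin_le_nhds
      rw [zero_mul] at hlim
      exact ge_of_tendsto hlim (by filter_upwards [self_mem_nhdsWithin] with ε hε using key ε hε)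
    exact le_of_tendsto' (tendsto_clm_apply hzsk (tendsto_const_nhds.sub hzk)) this
  · rintro ⟨hv, h⟩
    refine regularNormalCone_subset_normalCone _ _ ⟨hv, fun ε hε => ?_⟩
    filter_upwards [self_mem_nhdsWithin] with z hz
    exact (h z hz).trans (mul_nonneg hε.le (norm_nonneg _))

/-- The normal cone to a convex cone consists of the polar functionals vanishing at the point. -/
lemma mem_normalCone_of_convexCone {T : Set W} (hT : Convex ℝ T)
    (hT' : ∀ w ∈ T, ∀ s : ℝ, 0 ≤ s → s • w ∈ T) {v : W} {zs : StrongDual ℝ W} :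
    zs ∈ normalCone T v ↔ v ∈ T ∧ (∀ w ∈ T, zs w ≤ 0) ∧ zs v = 0 := by
  rw [mem_normalCone_of_convex hT]
  constructor
  · rintro ⟨hv, h⟩
    have h0 := h ((0 : ℝ) • v) (hT' v hv 0 le_rfl)
    have h2 := h ((2 : ℝ) • v) (hT' v hv 2 (by norm_num))
    simp only [map_sub, map_smul, smul_eq_mul] at h0 h2
    have hz : zs v = 0 := by linarith
    refine ⟨hv, fun w hw => ?_, hz⟩
    have := h w hw
    rw [map_sub, hz] at this
    linarith
  · rintro ⟨hv, h, hz⟩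
    refine ⟨hv, fun w hw => ?_⟩
    rw [map_sub, hz, sub_zero]
    exact h w hw

/-- First-order necessary condition for a local minimum relative to a set. -/
lemma neg_mem_regularNormalCone_of_isLocalMinOn {S : Set W} {f : W → ℝ} {f' : StrongDual ℝ W}
    {z : W} (hf : HasFDerivAt f f' z) (hz : z ∈ S) (hmin : IsLocalMinOn f S z) :
    -f' ∈ regularNormalCone S z := by
  refine ⟨hz, fun ε hε => ?_⟩
  filter_upwards [hmin, nhdsWithin_le_nhds (hf.isLittleO.bound hε)] with y h1 h2
  have h3 := (le_abs_self _).trans h2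
  simp only [neg_apply]
  linarith

end Normals

/-! ### Second-order expansions -/

section Taylor

variable {Z F : Type*} [NormedAddCommGroup Z] [NormedSpace ℝ Z]
  [NormedAddCommGroup F] [NormedSpace ℝ F] {f : Z → F} {z₀ : Z}

/-- Second-order Taylor expansion with Peano remainder. -/
lemma isLittleO_taylor_two (hf : ContDiffAt ℝ 2 f z₀) :
    (fun d : Z => f (z₀ + d) - f z₀ - fderiv ℝ f z₀ d - (1 / 2 : ℝ) • fderiv ℝ (fderiv ℝ f) z₀ d d)
      =o[𝓝 0] fun d => ‖d‖ ^ 2 := by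
  set A := fderiv ℝ f z₀ with hA
  set D := fderiv ℝ (fderiv ℝ f) z₀ with hD
  have hsymm : ∀ v w, D v w = D w v := fun v w =>
    (hf.isSymmSndFDerivAt (by simp)) v w
  have hD1 : HasFDerivAt (fderiv ℝ f) D z₀ :=
    ((hf.fderiv_right (m := 1) (by norm_num)).differentiableAt (by norm_num)).hasFDerivAt
  have hdiff : ∀ᶠ z in 𝓝 z₀, DifferentiableAt ℝ f z :=
    (hf.eventually (by norm_num)).mono fun z hz => hz.differentiableAt (by norm_num)
  refine Asymptotics.isLittleO_iff.2 fun c hc => ?_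
  obtain ⟨δ, hδ, hball⟩ := Metric.eventually_nhds_iff.1 (hdiff.and (hD1.isLittleO.bound hc))
  filter_upwards [Metric.ball_mem_nhds (0 : Z) hδ] with d hd
  rw [mem_ball_zero_iff] at hd
  let R : Z → F := fun z => f z - A (z - z₀) - (1 / 2 : ℝ) • D (z - z₀) (z - z₀)
  have hsub : ∀ z, HasFDerivAt (fun z => z - z₀) (ContinuousLinearMap.id ℝ Z) z :=
    fun z => (hasFDerivAt_id z).sub_const z₀
  have hR : ∀ z ∈ Metric.closedBall z₀ ‖d‖, HasFDerivWithinAt R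
      (fderiv ℝ f z - A - D (z - z₀)) (Metric.closedBall z₀ ‖d‖) z := by
    intro z hz
    have h1 := (hball (lt_of_le_of_lt hz hd)).1.hasFDerivAt
    have h2 : HasFDerivAt (fun z => A (z - z₀)) A z := by
      exact A.hasFDerivAt.comp z (hsub z)
    have h3 : HasFDerivAt (fun z => D (z - z₀)) D z := by
      exact D.hasFDerivAt.comp z (hsub z)
    have h4 := (h3.clm_apply (hsub z)).const_smul (1 / 2 : ℝ)
    refine ((h1.sub h2).sub h4).hasFDerivWithinAt.congr_fderiv ?_
    congr 1
    ext w
    simp only [smul_apply, add_apply, ContinuousLinearMap.comp_apply,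
      ContinuousLinearMap.flip_apply, ContinuousLinearMap.id_apply, hsymm w]
    module
  have hbound : ∀ z ∈ Metric.closedBall z₀ ‖d‖, ‖fderiv ℝ f z - A - D (z - z₀)‖ ≤ c * ‖d‖ := by
    intro z hz
    refine ((hball (lt_of_le_of_lt hz hd)).2).trans (mul_le_mul_of_nonneg_left ?_ hc.le)
    rwa [← dist_eq_norm]
  have key := (convex_closedBall z₀ ‖d‖).norm_image_sub_le_of_norm_hasFDerivWithin_le hR hbound
    (x := z₀) (y := z₀ + d) (by simp) (by simp)
  simp only [R, add_sub_cancel_left, sub_self, map_zero, smul_zero, sub_zero] at key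
  rw [Real.norm_of_nonneg (by positivity), pow_two, ← mul_assoc]
  convert key using 2
  module

variable {t : ℕ → ℝ} {w : ℕ → Z} {w₀ : Z}

lemma tendsto_add_smul (ht0 : Tendsto t atTop (𝓝 0)) (hw : Tendsto w atTop (𝓝 w₀)) :
    Tendsto (fun k => z₀ + t k • w k) atTop (𝓝 z₀) := by
  simpa using! (ht0.smul hw).const_add z₀

lemma tendsto_taylor_two (hf : ContDiffAt ℝ 2 f z₀) (ht : ∀ k, 0 < t k)
    (ht0 : Tendsto t atTop (𝓝 0)) (hw : Tendsto w atTop (𝓝 w₀)) :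
    Tendsto (fun k => (t k ^ 2)⁻¹ • (f (z₀ + t k • w k) - f z₀ - t k • fderiv ℝ f z₀ (w k))) atTop
      (𝓝 ((1 / 2 : ℝ) • fderiv ℝ (fderiv ℝ f) z₀ w₀ w₀)) := by
  set D := fderiv ℝ (fderiv ℝ f) z₀ with hD
  have hd0 : Tendsto (fun k => t k • w k) atTop (𝓝 0) := by simpa using ht0.smul hw
  have h1 := (isLittleO_taylor_two hf).comp_tendsto hd0
  have h2 : (fun k => ‖t k • w k‖ ^ 2) =O[atTop] fun k => t k ^ 2 := by
    have hb : (fun k => ‖w k‖ ^ 2) =O[atTop] fun _ => (1 : ℝ) :=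
      (hw.norm.pow 2).isBigO_one ℝ
    refine ((Asymptotics.isBigO_refl (fun k => t k ^ 2) atTop).mul hb).congr (fun k => ?_)
      (fun k => by simp)
    rw [norm_smul, mul_pow, Real.norm_of_nonneg (ht k).le]
  have h3 := (h1.trans_isBigO h2).tendsto_inv_smul_nhds_zero
  have h4 : Tendsto (fun k => (1 / 2 : ℝ) • D (w k) (w k)) atTop (𝓝 ((1 / 2 : ℝ) • D w₀ w₀)) :=
    (tendsto_clm_apply (tendsto_clm_apply tendsto_const_nhds hw) hw).const_smul _
  refine ((h3.add h4).congr fun k => ?_).trans (by rw [zero_add])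
  have := (ht k).ne'
  simp only [Function.comp, map_smul, smul_apply, smul_sub, smul_smul]
  have e : (t k ^ 2)⁻¹ * (1 / 2 * (t k * t k)) = 1 / 2 := by field_simp
  rw [e]
  module

lemma tendsto_inv_smul_sub {f' : Z →L[ℝ] F} (hf : HasFDerivAt f f' z₀) (ht : ∀ k, 0 < t k)
    (ht0 : Tendsto t atTop (𝓝 0)) (hw : Tendsto w atTop (𝓝 w₀)) :
    Tendsto (fun k => (t k)⁻¹ • (f (z₀ + t k • w k) - f z₀)) atTop (𝓝 (f' w₀)) := by
  refine (hasFDerivWithinAt_univ.2 hf).lim (by simpa using ht0.smul hw)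
    (Eventually.of_forall fun _ => mem_univ _) (hw.congr fun k => ?_)
  rw [smul_smul, inv_mul_cancel₀ (ht k).ne', one_smul]

end Taylor

/-! ### The Farkas lemma -/

/-- The Farkas lemma for finitely many functionals on a vector space, by induction on their number:
if the last functional cannot be dropped, then a vector `w₀` at which it equals one and the others
are nonpositive allows one to eliminate it. -/
theorem exists_nonneg_combination {ι V : Type*} [AddCommGroup V] [Module ℝ V] (s : Finset ι)
    (f : ι → V →ₗ[ℝ] ℝ) (c : V →ₗ[ℝ] ℝ) (h : ∀ w, (∀ i ∈ s, f i w ≤ 0) → c w ≤ 0) :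
    ∃ a : ι → ℝ, (∀ i ∈ s, 0 ≤ a i) ∧ c = ∑ i ∈ s, a i • f i := by
  classical
  induction s using Finset.induction_on generalizing f c with
  | empty =>
    refine ⟨0, by simp, ?_⟩
    ext w
    have h1 := h w (by simp)
    have h2 := h (-w) (by simp)
    rw [map_neg] at h2
    simp
    linarith
  | insert j s hj ih =>
    by_cases hred : ∀ w, (∀ i ∈ s, f i w ≤ 0) → c w ≤ 0
    · obtain ⟨a, ha, hc⟩ := ih f c hred
      refine ⟨Function.update a j 0, fun i hi => ?_, ?_⟩
      · by_cases hij : i = j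
        · simp [hij]
        · simpa [hij] using ha i ((Finset.mem_insert.1 hi).resolve_left hij)
      · rw [Finset.sum_insert hj, hc]
        simp only [Function.update_self, zero_smul, zero_add]
        refine Finset.sum_congr rfl fun i hi => ?_
        rw [Function.update_of_ne (ne_of_mem_of_not_mem hi hj)]
    · push Not at hred
      obtain ⟨w₁, hw₁, hcw₁⟩ := hred
      have hfj : 0 < f j w₁ := by
        by_contra hneg
        push Not at hneg
        have := h w₁ fun i hi => by
          rcases Finset.mem_insert.1 hi with rfl | hi
          · exact hneg
          · exact hw₁ i hi
        linarith
      set w₀ := (f j w₁)⁻¹ • w₁ with hw₀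
      have hj1 : f j w₀ = 1 := by
        rw [hw₀, map_smul, smul_eq_mul, inv_mul_cancel₀ hfj.ne']
      have hs0 : ∀ i ∈ s, f i w₀ ≤ 0 := fun i hi => by
        rw [hw₀, map_smul, smul_eq_mul]
        exact mul_nonpos_of_nonneg_of_nonpos (inv_pos.2 hfj).le (hw₁ i hi)
      have hc0 : 0 < c w₀ := by
        rw [hw₀, map_smul, smul_eq_mul]
        exact mul_pos (inv_pos.2 hfj) hcw₁
      obtain ⟨a, ha, hc⟩ := ih (fun i => f i - f i w₀ • f j) (c - c w₀ • f j) (by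
        intro w hw
        have := h (w - f j w • w₀) fun i hi => by
          rcases Finset.mem_insert.1 hi with rfl | hi
          · simp [hj1]
          · have := hw i hi
            simp only [LinearMap.sub_apply, LinearMap.smul_apply, smul_eq_mul] at this
            simp only [map_sub, map_smul, smul_eq_mul]
            linarith
        simp only [map_sub, map_smul, smul_eq_mul] at this
        simp only [LinearMap.sub_apply, LinearMap.smul_apply, smul_eq_mul]
        linarith)
      refine ⟨Function.update a j (c w₀ - ∑ i ∈ s, a i * f i w₀), fun i hi => ?_, ?_⟩
      · by_cases hij : i = j
        · subst hij
          rw [Function.update_self]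
          have : ∑ i ∈ s, a i * f i w₀ ≤ 0 := Finset.sum_nonpos fun i hi =>
            mul_nonpos_of_nonneg_of_nonpos (ha i hi) (hs0 i hi)
          linarith
        · simpa [hij] using ha i ((Finset.mem_insert.1 hi).resolve_left hij)
      · rw [Finset.sum_insert hj, Function.update_self]
        have hcongr : ∑ i ∈ s, Function.update a j (c w₀ - ∑ i ∈ s, a i * f i w₀) i • f i
            = ∑ i ∈ s, a i • f i :=
          Finset.sum_congr rfl fun i hi => by
            rw [Function.update_of_ne (ne_of_mem_of_not_mem hi hj)]
        rw [hcongr]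
        refine (eq_add_of_sub_eq hc).trans ?_
        ext w
        simp only [LinearMap.add_apply, LinearMap.sum_apply, LinearMap.smul_apply,
          LinearMap.sub_apply, smul_eq_mul, sub_mul, mul_sub, Finset.sum_sub_distrib,
          Finset.sum_mul, mul_assoc]
        ring

/-! ### Stable reductions -/

section Reduction

variable {P X E : Type*} [NormedAddCommGroup P] [NormedSpace ℝ P]
  [NormedAddCommGroup X] [NormedSpace ℝ X]
  [NormedAddCommGroup E] [InnerProductSpace ℝ E]

/-- On the open neighbourhood `U` of `z₀` the set `S` of pairs `(p, x)` is described by the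
inclusion `G (p, x) ∈ K` with `G` of class `C²` and `G z₀ = 0`, and the distance of `x` to the
section of `S` at `p` is bounded by `κ` times the residual of this inclusion. -/
structure IsStableReduction (S : Set (P × X)) (G : P × X → E) (K : ProperCone ℝ E) (z₀ : P × X)
    (κ : ℝ) (U : Set (P × X)) : Prop where
  nonneg : 0 ≤ κ
  isOpen : IsOpen U
  mem : z₀ ∈ U
  contDiffAt : ∀ z ∈ U, ContDiffAt ℝ 2 G z
  map_zero : G z₀ = 0
  mem_iff : ∀ z ∈ U, (z ∈ S ↔ G z ∈ K)
  error_bound : ∀ z ∈ U, ∃ x', (z.1, x') ∈ S ∧ ‖x' - z.2‖ ≤ κ * Metric.infDist (G z) K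

variable {S : Set (P × X)} {G : P × X → E} {K : ProperCone ℝ E} {z₀ : P × X} {κ : ℝ}
  {U : Set (P × X)}

namespace IsStableReduction

variable (M : IsStableReduction S G K z₀ κ U)
include M

lemma mem_nhds {z : P × X} (hz : z ∈ U) : U ∈ 𝓝 z := M.isOpen.mem_nhds hz

lemma hasFDerivAt {z : P × X} (hz : z ∈ U) : HasFDerivAt G (fderiv ℝ G z) z :=
  ((M.contDiffAt z hz).differentiableAt (by norm_num)).hasFDerivAt

lemma continuousAt_fderiv {z : P × X} (hz : z ∈ U) : ContinuousAt (fderiv ℝ G) z :=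
  ((M.contDiffAt z hz).fderiv_right (m := 1) (by norm_num)).continuousAt

lemma hasFDerivAt_fderiv : HasFDerivAt (fderiv ℝ G) (fderiv ℝ (fderiv ℝ G) z₀) z₀ :=
  (((M.contDiffAt z₀ M.mem).fderiv_right (m := 1) (by norm_num)).differentiableAt
    (by norm_num)).hasFDerivAt

lemma exists_near {z : P × X} (hz : z ∈ U) :
    ∃ z' ∈ S, ‖z' - z‖ ≤ κ * Metric.infDist (G z) K := by
  obtain ⟨x', h1, h2⟩ := M.error_bound z hz
  refine ⟨(z.1, x'), h1, ?_⟩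
  rw [Prod.norm_def]
  simpa using h2

lemma hasFDerivAt_section {z : P × X} (hz : z ∈ U) :
    HasFDerivAt (fun x => G (z.1, x)) ((fderiv ℝ G z).comp (ContinuousLinearMap.inr ℝ P X)) z.2 :=
  HasFDerivAt.comp z.2 (f := fun x => (z.1, x)) (M.hasFDerivAt hz) (hasFDerivAt_prodMk_right _ _)

/-- Multiplier rule for the normal cones to the sections of `S`. -/
lemma exists_multiplier_section [FiniteDimensional ℝ E] [FiniteDimensional ℝ X] {z : P × X}
    (hz : z ∈ U) {xs : StrongDual ℝ X} (hxs : xs ∈ normalCone {x | (z.1, x) ∈ S} z.2) :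
    ∃ ν ∈ polarCone K, ‖ν‖ ≤ κ * ‖xs‖ ∧
      ν.comp ((fderiv ℝ G z).comp (ContinuousLinearMap.inr ℝ P X)) = xs ∧ ν (G z) = 0 := by
  have hfd : ∀ x, (z.1, x) ∈ U → HasFDerivAt (fun x => G (z.1, x))
      ((fderiv ℝ G (z.1, x)).comp (ContinuousLinearMap.inr ℝ P X)) x :=
    fun x hx => M.hasFDerivAt_section hx
  have hcont : Continuous fun x : X => (z.1, x) := by fun_prop
  obtain ⟨ν, h1, h2, h3, h4⟩ := exists_multiplier_of_mem_normalCone (K := K)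
    (F := fun x => G (z.1, x)) (U := {x | (z.1, x) ∈ U}) M.nonneg (M.isOpen.preimage hcont) hz
    (fun x hx => (hfd x hx).differentiableAt.differentiableWithinAt)
    (ContinuousOn.congr (f := fun x =>
        (fderiv ℝ G (z.1, x)).comp (ContinuousLinearMap.inr ℝ P X))
      (fun x hx => by
        have h1 : ContinuousAt (fun x => fderiv ℝ G (z.1, x)) x :=
          ContinuousAt.comp (M.continuousAt_fderiv (z := (z.1, x)) hx) hcont.continuousAt
        exact (h1.clm_comp continuousAt_const).continuousWithinAt)
      (fun x hx => (hfd x hx).fderiv))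
    (fun x hx hxS => (M.mem_iff _ hx).1 hxS) (fun x hx => M.error_bound (z.1, x) hx) hxs
  exact ⟨ν, h1, h2, by rw [← h3, (hfd z.2 hz).fderiv], h4⟩

lemma exists_multiplier [FiniteDimensional ℝ E] [FiniteDimensional ℝ P] [FiniteDimensional ℝ X]
    {z : P × X} (hz : z ∈ U) {zs : StrongDual ℝ (P × X)} (hzs : zs ∈ regularNormalCone S z) :
    ∃ ν ∈ polarCone K, ν.comp (fderiv ℝ G z) = zs ∧ ν (G z) = 0 := by
  obtain ⟨ν, h1, -, h2, h3⟩ := exists_multiplier_of_mem_regularNormalCone M.nonneg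
    (M.hasFDerivAt hz) ((M.mem_iff z hz).1 hzs.1)
    (by filter_upwards [M.mem_nhds hz] with z' hz' using M.exists_near hz') hzs
  exact ⟨ν, h1, h2, h3⟩

lemma comp_mem_normalCone_section {z : P × X} (hz : z ∈ U) (hzS : z ∈ S) {ν : StrongDual ℝ E}
    (hν : ν ∈ polarCone K) (hνz : ν (G z) = 0) :
    ν.comp ((fderiv ℝ G z).comp (ContinuousLinearMap.inr ℝ P X)) ∈
      normalCone {x | (z.1, x) ∈ S} z.2 := by
  refine regularNormalCone_subset_normalCone _ _
    (comp_mem_regularNormalCone (M.hasFDerivAt_section hz) hzS ?_ hν hνz)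
  have hcont : ContinuousAt (fun x : X => (z.1, x)) z.2 := by fun_prop
  filter_upwards [hcont (M.mem_nhds hz)] with x hx hxS using (M.mem_iff _ hx).1 hxS

lemma map_tendsto_mem {t : ℕ → ℝ} {w : ℕ → P × X} {w₀ : P × X} (ht : ∀ k, 0 < t k)
    (ht0 : Tendsto t atTop (𝓝 0)) (hw : Tendsto w atTop (𝓝 w₀))
    (hS : ∀ᶠ k in atTop, z₀ + t k • w k ∈ S) : fderiv ℝ G z₀ w₀ ∈ K := by
  have h1 := tendsto_inv_smul_sub (M.hasFDerivAt M.mem) ht ht0 hw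
  refine K.isClosed.mem_of_tendsto h1 ?_
  filter_upwards [hS, (tendsto_add_smul ht0 hw).eventually (M.mem_nhds M.mem)] with k hk hkU
  rw [M.map_zero, sub_zero]
  exact K.smul_mem ((M.mem_iff _ hkU).1 hk) (inv_pos.2 (ht k)).le

/-- The error bound makes the linearization exact. -/
lemma tangentCone_eq : tangentCone S z₀ = {w | fderiv ℝ G z₀ w ∈ K} := by
  ext w
  constructor
  · rintro ⟨t, wk, ht, ht0, hwk, hk⟩
    exact M.map_tendsto_mem ht ht0 hwk (Eventually.of_forall hk)
  · intro hw
    have hw : fderiv ℝ G z₀ w ∈ K := hw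
    set t : ℕ → ℝ := fun k => 1 / ((k : ℝ) + 1) with ht_def
    have ht : ∀ k, 0 < t k := fun k => Nat.one_div_pos_of_nat
    have ht0 : Tendsto t atTop (𝓝 0) := tendsto_one_div_add_atTop_nhds_zero_nat
    have hev := (tendsto_add_smul (z₀ := z₀) ht0 (tendsto_const_nhds (x := w))).eventually
      (M.mem_nhds M.mem)
    have hder := tendsto_inv_smul_sub (M.hasFDerivAt M.mem) ht ht0 (tendsto_const_nhds (x := w))
    have hy : ∀ k, ∃ y, z₀ + t k • w ∈ U → z₀ + t k • y ∈ S ∧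
        ‖y - w‖ ≤ κ * ‖(t k)⁻¹ • (G (z₀ + t k • w) - G z₀) - fderiv ℝ G z₀ w‖ := by
      intro k
      by_cases hkU : z₀ + t k • w ∈ U
      · obtain ⟨z', hz', hn⟩ := M.exists_near hkU
        have hne := (ht k).ne'
        refine ⟨(t k)⁻¹ • (z' - z₀), fun _ => ⟨by
          rwa [smul_smul, mul_inv_cancel₀ hne, one_smul, add_sub_cancel], ?_⟩⟩
        have e1 : (t k)⁻¹ • (z' - z₀) - w = (t k)⁻¹ • (z' - (z₀ + t k • w)) := by
          simp only [smul_sub, smul_add, smul_smul, inv_mul_cancel₀ hne, one_smul]; abel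
        have e2 : (t k)⁻¹ • (G (z₀ + t k • w) - G z₀) - fderiv ℝ G z₀ w =
            (t k)⁻¹ • (G (z₀ + t k • w) - t k • fderiv ℝ G z₀ w) := by
          simp only [M.map_zero, sub_zero, smul_sub, smul_smul, inv_mul_cancel₀ hne, one_smul]
        rw [e1, e2, norm_smul, norm_smul, Real.norm_of_nonneg (inv_pos.2 (ht k)).le,
          mul_left_comm]
        refine mul_le_mul_of_nonneg_left (hn.trans (mul_le_mul_of_nonneg_left ?_ M.nonneg))
          (inv_pos.2 (ht k)).le
        rw [← dist_eq_norm]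
        exact Metric.infDist_le_dist_of_mem (K.smul_mem hw (ht k).le)
      · exact ⟨0, fun h => absurd h hkU⟩
    choose y hy using hy
    have hlim : Tendsto y atTop (𝓝 w) := by
      rw [tendsto_iff_norm_sub_tendsto_zero]
      have h0 : Tendsto (fun k => κ * ‖(t k)⁻¹ • (G (z₀ + t k • w) - G z₀) - fderiv ℝ G z₀ w‖)
          atTop (𝓝 0) := by
        simpa using! (tendsto_iff_norm_sub_tendsto_zero.1 hder).const_mul κ
      exact squeeze_zero' (Eventually.of_forall fun _ => norm_nonneg _)
        (hev.mono fun k hk => (hy k hk).2) h0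
    obtain ⟨N, hN⟩ := eventually_atTop.1 hev
    exact ⟨fun k => t (k + N), fun k => y (k + N), fun k => ht _,
      (tendsto_add_atTop_iff_nat N).2 ht0, (tendsto_add_atTop_iff_nat N).2 hlim,
      fun k => (hy _ (hN _ (by omega))).1⟩

end IsStableReduction

end Reduction

/-! ### Tangents to the graph: necessity -/

section Necessity

variable {P X E : Type*} [NormedAddCommGroup P] [NormedSpace ℝ P]
  [NormedAddCommGroup X] [NormedSpace ℝ X]
  [NormedAddCommGroup E] [InnerProductSpace ℝ E]

/-- The reduced form of the tangent vectors `(v, us)` to the graph of the normal cone mapping at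
`(z₀, xs)`: the multiplier `μ` of the reduced system solves the directional dual problem, and `ws`
is a normal to the critical cone `{w | A w ∈ K, μ (A w) = 0}` at `v`, where `A = ∇G(z₀)`. -/
structure IsReducedTangent (G : P × X → E) (K : ProperCone ℝ E) (z₀ : P × X) (xs : StrongDual ℝ X)
    (v : P × X) (us : StrongDual ℝ X) (μ : StrongDual ℝ E) (ws : StrongDual ℝ (P × X)) :
    Prop where
  mem : fderiv ℝ G z₀ v ∈ K
  polar : μ ∈ polarCone K
  apply_eq_zero : μ (fderiv ℝ G z₀ v) = 0
  comp_eq : μ.comp ((fderiv ℝ G z₀).comp (ContinuousLinearMap.inr ℝ P X)) = xs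
  maximal : ∀ μ' ∈ polarCone K, μ'.comp (fderiv ℝ G z₀) = μ.comp (fderiv ℝ G z₀) →
    μ' (fderiv ℝ (fderiv ℝ G) z₀ v v) ≤ μ (fderiv ℝ (fderiv ℝ G) z₀ v v)
  normal_nonpos : ∀ w, fderiv ℝ G z₀ w ∈ K → μ (fderiv ℝ G z₀ w) = 0 → ws w ≤ 0
  normal_apply : ws v = 0
  eq : us = (μ.comp (fderiv ℝ (fderiv ℝ G) z₀ v)).comp (ContinuousLinearMap.inr ℝ P X) +
    ws.comp (ContinuousLinearMap.inr ℝ P X)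

/-- Points `z₀ + t k • w k` and normals `xs + t k • u k` that realize the tangent vector `(v, us)`,
together with a convergent sequence of multipliers `m k → μ`. -/
structure IsMultiplierSequence (G : P × X → E) (K : ProperCone ℝ E) (z₀ : P × X)
    (xs : StrongDual ℝ X) (v : P × X) (us : StrongDual ℝ X) (t : ℕ → ℝ) (w : ℕ → P × X)
    (u : ℕ → StrongDual ℝ X) (m : ℕ → StrongDual ℝ E) (μ : StrongDual ℝ E) : Prop where
  pos : ∀ k, 0 < t k
  tendsto_t : Tendsto t atTop (𝓝 0)
  tendsto_w : Tendsto w atTop (𝓝 v)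
  tendsto_u : Tendsto u atTop (𝓝 us)
  tendsto_m : Tendsto m atTop (𝓝 μ)
  mem : ∀ k, G (z₀ + t k • w k) ∈ K
  polar : ∀ k, m k ∈ polarCone K
  comp_eq : ∀ k, (m k).comp ((fderiv ℝ G (z₀ + t k • w k)).comp (ContinuousLinearMap.inr ℝ P X))
    = xs + t k • u k
  apply_eq_zero : ∀ k, m k (G (z₀ + t k • w k)) = 0

variable {S : Set (P × X)} {G : P × X → E} {K : ProperCone ℝ E} {z₀ : P × X} {κ : ℝ}
  {U : Set (P × X)} {xs : StrongDual ℝ X} {v : P × X} {us : StrongDual ℝ X}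

/-- The error bound gives bounded multipliers for the approximating normals, so that a subsequence
of them converges. -/
lemma exists_isMultiplierSequence [FiniteDimensional ℝ E] [FiniteDimensional ℝ X]
    (M : IsStableReduction S G K z₀ κ U) {t : ℕ → ℝ} {w : ℕ → P × X} {u : ℕ → StrongDual ℝ X}
    (ht : ∀ k, 0 < t k) (ht0 : Tendsto t atTop (𝓝 0)) (hw : Tendsto w atTop (𝓝 v))
    (hu : Tendsto u atTop (𝓝 us))
    (hk : ∀ k, xs + t k • u k ∈ normalCone {x | ((z₀ + t k • w k).1, x) ∈ S} (z₀ + t k • w k).2) :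
    ∃ t w u m μ, IsMultiplierSequence G K z₀ xs v us t w u m μ := by
  have hU : ∀ᶠ k in atTop, z₀ + t k • w k ∈ U :=
    (tendsto_add_smul ht0 hw).eventually (M.mem_nhds M.mem)
  have hmult : ∀ k, ∃ ν : StrongDual ℝ E, z₀ + t k • w k ∈ U → ν ∈ polarCone K ∧
      ‖ν‖ ≤ κ * ‖xs + t k • u k‖ ∧ ν.comp ((fderiv ℝ G (z₀ + t k • w k)).comp
        (ContinuousLinearMap.inr ℝ P X)) = xs + t k • u k ∧ ν (G (z₀ + t k • w k)) = 0 := by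
    intro k
    by_cases hkU : z₀ + t k • w k ∈ U
    · obtain ⟨ν, h⟩ := M.exists_multiplier_section hkU (hk k)
      exact ⟨ν, fun _ => h⟩
    · exact ⟨0, fun h => absurd h hkU⟩
  choose m hm using hmult
  have hxlim : Tendsto (fun k => xs + t k • u k) atTop (𝓝 (xs + (0 : ℝ) • us)) :=
    (ht0.smul hu).const_add xs
  obtain ⟨R, hR⟩ := hxlim.norm.bddAbove_range
  have hb : ∃ᶠ k in atTop, m k ∈ Metric.closedBall (0 : StrongDual ℝ E) (κ * R) := by
    refine (hU.mono fun k hkU => ?_).frequently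
    rw [mem_closedBall_zero_iff]
    exact (hm k hkU).2.1.trans (mul_le_mul_of_nonneg_left (hR ⟨k, rfl⟩) M.nonneg)
  obtain ⟨μ, -, φ, hφ, hlim⟩ := tendsto_subseq_of_frequently_bounded Metric.isBounded_closedBall hb
  obtain ⟨N, hN⟩ := eventually_atTop.1 (hφ.tendsto_atTop.eventually hU)
  let ψ : ℕ → ℕ := fun k => φ (k + N)
  have hψ : Tendsto ψ atTop atTop := hφ.tendsto_atTop.comp (tendsto_add_atTop_nat N)
  have hψU : ∀ k, z₀ + t (ψ k) • w (ψ k) ∈ U := fun k => hN _ (by omega)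
  exact ⟨t ∘ ψ, w ∘ ψ, u ∘ ψ, m ∘ ψ, μ,
    { pos := fun k => ht _
      tendsto_t := ht0.comp hψ
      tendsto_w := hw.comp hψ
      tendsto_u := hu.comp hψ
      tendsto_m := hlim.comp (tendsto_add_atTop_nat N)
      mem := fun k => (M.mem_iff _ (hψU k)).1 (hk (ψ k)).1
      polar := fun k => (hm _ (hψU k)).1
      comp_eq := fun k => (hm _ (hψU k)).2.2.1
      apply_eq_zero := fun k => (hm _ (hψU k)).2.2.2 }⟩

namespace IsMultiplierSequence

variable {t : ℕ → ℝ} {w : ℕ → P × X} {u : ℕ → StrongDual ℝ X} {m : ℕ → StrongDual ℝ E}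
  {μ : StrongDual ℝ E}
  (Q : IsMultiplierSequence G K z₀ xs v us t w u m μ) (M : IsStableReduction S G K z₀ κ U)
include Q

lemma polar_limit : μ ∈ polarCone K :=
  (isClosed_polarCone K).mem_of_tendsto Q.tendsto_m (Eventually.of_forall Q.polar)

include M

lemma tendsto_inv_smul :
    Tendsto (fun k => (t k)⁻¹ • G (z₀ + t k • w k)) atTop (𝓝 (fderiv ℝ G z₀ v)) := by
  refine (tendsto_inv_smul_sub (M.hasFDerivAt M.mem) Q.pos Q.tendsto_t Q.tendsto_w).congr
    fun k => ?_
  rw [M.map_zero, sub_zero]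

lemma apply_mem : fderiv ℝ G z₀ v ∈ K :=
  K.isClosed.mem_of_tendsto (Q.tendsto_inv_smul M) (Eventually.of_forall fun k =>
    K.smul_mem (Q.mem k) (inv_pos.2 (Q.pos k)).le)

lemma apply_limit_eq_zero : μ (fderiv ℝ G z₀ v) = 0 := by
  refine tendsto_nhds_unique (tendsto_clm_apply Q.tendsto_m (Q.tendsto_inv_smul M))
    (tendsto_const_nhds.congr fun k => ?_)
  rw [map_smul, Q.apply_eq_zero, smul_zero]

lemma comp_limit_eq :
    μ.comp ((fderiv ℝ G z₀).comp (ContinuousLinearMap.inr ℝ P X)) = xs := by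
  have h1 : Tendsto (fun k => fderiv ℝ G (z₀ + t k • w k)) atTop (𝓝 (fderiv ℝ G z₀)) :=
    (M.continuousAt_fderiv M.mem).tendsto.comp (tendsto_add_smul Q.tendsto_t Q.tendsto_w)
  have h2 := tendsto_clm_comp Q.tendsto_m
    (tendsto_clm_comp h1 (tendsto_const_nhds (x := ContinuousLinearMap.inr ℝ P X)))
  have h3 : Tendsto (fun k => xs + t k • u k) atTop (𝓝 xs) := by
    simpa using! (Q.tendsto_t.smul Q.tendsto_u).const_add xs
  exact tendsto_nhds_unique h2 (h3.congr fun k => (Q.comp_eq k).symm)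

/-- The difference quotients of the multipliers converge after composition with `∇ₓG(z₀)`: subtract
from the difference quotient of the normals the contribution of the variation of `∇ₓG`. -/
lemma tendsto_quotient :
    Tendsto (fun k => (t k)⁻¹ • (m k - μ).comp
        ((fderiv ℝ G z₀).comp (ContinuousLinearMap.inr ℝ P X))) atTop
      (𝓝 (us - (μ.comp (fderiv ℝ (fderiv ℝ G) z₀ v)).comp (ContinuousLinearMap.inr ℝ P X))) := by
  have h1 := tendsto_inv_smul_sub M.hasFDerivAt_fderiv Q.pos Q.tendsto_t Q.tendsto_w
  have h2 := tendsto_clm_comp (tendsto_clm_comp Q.tendsto_m h1)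
    (tendsto_const_nhds (x := ContinuousLinearMap.inr ℝ P X))
  refine (Q.tendsto_u.sub h2).congr fun k => ?_
  have hne := (Q.pos k).ne'
  have h3 := Q.comp_eq k
  have h4 := Q.comp_limit_eq M
  rw [← h4] at h3
  ext x
  have h5 := congrArg (fun f => (t k)⁻¹ * f x) h3
  simp only [add_apply, smul_apply, sub_apply, ContinuousLinearMap.comp_apply, smul_eq_mul,
    map_smul, map_sub] at h5 ⊢
  rw [mul_add, inv_mul_cancel_left₀ hne] at h5
  linarith

/-- The limit multiplier is directionally optimal as soon as its complementarity defect along the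
sequence is of smaller order than the square of the step: compare the two multipliers at the
feasible points and expand to second order. -/
lemma le_of_frequently
    (h : ∀ ε : ℝ, 0 < ε → ∃ᶠ k in atTop, -ε ≤ (t k ^ 2)⁻¹ * μ (G (z₀ + t k • w k)))
    {μ' : StrongDual ℝ E} (hμ' : μ' ∈ polarCone K)
    (hcomp : μ'.comp (fderiv ℝ G z₀) = μ.comp (fderiv ℝ G z₀)) :
    μ' (fderiv ℝ (fderiv ℝ G) z₀ v v) ≤ μ (fderiv ℝ (fderiv ℝ G) z₀ v v) := by
  have h1 := tendsto_taylor_two (M.contDiffAt z₀ M.mem) Q.pos Q.tendsto_t Q.tendsto_w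
  have h2 := ((μ' - μ).continuous.tendsto _).comp h1
  have key : ∀ ε : ℝ, 0 < ε →
      (μ' - μ) ((1 / 2 : ℝ) • fderiv ℝ (fderiv ℝ G) z₀ v v) ≤ ε := by
    intro ε hε
    refine isClosed_Iic.mem_of_frequently_of_tendsto ((h ε hε).mono fun k hk => ?_) h2
    have h3 := hμ' _ (Q.mem k)
    have h4 : μ' (fderiv ℝ G z₀ (w k)) = μ (fderiv ℝ G z₀ (w k)) :=
      congrArg (fun f => f (w k)) hcomp
    have h5 : (t k ^ 2)⁻¹ * μ' (G (z₀ + t k • w k)) ≤ 0 :=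
      mul_nonpos_of_nonneg_of_nonpos (by positivity) h3
    simp only [Function.comp, mem_Iic, map_smul, sub_apply, map_sub, smul_eq_mul, M.map_zero,
      map_zero, h4]
    linarith
  have h6 := le_of_forall_pos_le_add (b := 0) fun ε hε => (key ε hε).trans_eq (zero_add ε).symm
  simp only [map_smul, sub_apply, smul_eq_mul] at h6
  linarith

/-- Necessity when the characteristic subspace is everything. Functionals on the lineality space
play no role, so that the convergence of the difference quotients of the multipliers extends from
`X` to `P × X`. -/
theorem exists_isReducedTangent_of_characteristic
    (L : P →L[ℝ] X) (hL : ∀ q, fderiv ℝ G z₀ (q, 0) - fderiv ℝ G z₀ (0, L q) ∈ K ∧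
      -(fderiv ℝ G z₀ (q, 0) - fderiv ℝ G z₀ (0, L q)) ∈ K) :
    ∃ ws, IsReducedTangent G K z₀ xs v us μ ws := by
  set A := fderiv ℝ G z₀ with hA
  set D := fderiv ℝ (fderiv ℝ G) z₀ with hD
  set us' := us - (μ.comp (D v)).comp (ContinuousLinearMap.inr ℝ P X) with hus'
  let Λ : P × X →L[ℝ] X :=
    L.comp (ContinuousLinearMap.fst ℝ P X) + ContinuousLinearMap.snd ℝ P X
  have hΛ : ∀ ν ∈ polarCone K, ∀ z : P × X, ν (A z) = ν (A (0, Λ z)) := by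
    intro ν hν z
    have h1 := hν _ (hL z.1).1
    have h2 := hν _ (hL z.1).2
    have h3 : A z = A (z.1, 0) + A (0, z.2) := by rw [← map_add]; simp
    have h4 : A (0, Λ z) = A (0, L z.1) + A (0, z.2) := by rw [← map_add]; simp [Λ]
    rw [map_neg] at h2
    rw [map_sub] at h1 h2
    rw [h3, h4, map_add, map_add]
    linarith
  have hquot : Tendsto (fun k => (t k)⁻¹ • (m k - μ).comp A) atTop (𝓝 (us'.comp Λ)) := by
    refine (tendsto_clm_comp (Q.tendsto_quotient M) (tendsto_const_nhds (x := Λ))).congr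
      fun k => ?_
    refine ContinuousLinearMap.ext fun z => ?_
    simp only [ContinuousLinearMap.comp_apply, smul_apply, sub_apply,
      ContinuousLinearMap.inr_apply, ← hA, hΛ _ (Q.polar k) z, hΛ _ Q.polar_limit z]
  have hnonpos : ∀ w', A w' ∈ K → μ (A w') = 0 → us'.comp Λ w' ≤ 0 := by
    intro w' h1 h2
    refine le_of_tendsto' (tendsto_clm_apply hquot (tendsto_const_nhds (x := w'))) fun k => ?_
    simp only [smul_apply, ContinuousLinearMap.comp_apply, sub_apply, h2, sub_zero, smul_eq_mul]
    exact mul_nonpos_of_nonneg_of_nonpos (inv_pos.2 (Q.pos k)).le (Q.polar k _ h1)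
  have hdefect : Tendsto (fun k => (t k ^ 2)⁻¹ * μ (G (z₀ + t k • w k))) atTop
      (𝓝 (-(us'.comp Λ v))) := by
    have h1 := tendsto_taylor_two (M.contDiffAt z₀ M.mem) Q.pos Q.tendsto_t Q.tendsto_w
    have h2 : Tendsto (fun k => μ - m k) atTop (𝓝 0) := by
      simpa using Q.tendsto_m.const_sub μ
    have h3 := (tendsto_clm_apply h2 h1).sub (tendsto_clm_apply hquot Q.tendsto_w)
    rw [zero_apply, zero_sub] at h3
    refine h3.congr fun k => ?_
    have hne := (Q.pos k).ne'
    simp only [smul_apply, ContinuousLinearMap.comp_apply, sub_apply, map_smul, map_sub,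
      smul_eq_mul, Q.apply_eq_zero k, M.map_zero, map_zero, ← hA]
    field_simp
    ring
  have hv : us'.comp Λ v = 0 := by
    refine le_antisymm (hnonpos v (Q.apply_mem M) (Q.apply_limit_eq_zero M)) ?_
    have := le_of_tendsto' hdefect fun k => mul_nonpos_of_nonneg_of_nonpos
      (by positivity) (Q.polar_limit _ (Q.mem k))
    linarith
  refine ⟨us'.comp Λ,
    { mem := Q.apply_mem M
      polar := Q.polar_limit
      apply_eq_zero := Q.apply_limit_eq_zero M
      comp_eq := Q.comp_limit_eq M
      maximal := fun μ' h1 h2 => Q.le_of_frequently M (fun ε hε => ?_) h1 h2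
      normal_nonpos := hnonpos
      normal_apply := hv
      eq := ?_ }⟩
  · rw [hv, neg_zero] at hdefect
    exact ((hdefect.eventually (lt_mem_nhds (neg_lt_zero.2 hε))).mono fun k hk => hk.le).frequently
  · have h1 : (us'.comp Λ).comp (ContinuousLinearMap.inr ℝ P X) = us' := by
      refine ContinuousLinearMap.ext fun x => ?_
      change us' (L 0 + x) = us' x
      rw [map_zero, zero_add]
    rw [h1, hus', add_sub_cancel]

end IsMultiplierSequence

/-- Moving from a point of a polyhedral cone in a direction that respects the active constraints
keeps the cone for short steps. -/
lemma exists_pos_add_smul_mem {s : Finset (StrongDual ℝ E)}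
    (hs : (K : Set E) = {y | ∀ φ ∈ s, φ y ≤ 0}) {y d : E} (hy : y ∈ K)
    (hd : ∀ φ ∈ s, φ y = 0 → φ d ≤ 0) : ∃ δ : ℝ, 0 < δ ∧ y + δ • d ∈ K := by
  have hmem : ∀ y, y ∈ K ↔ ∀ φ ∈ s, φ y ≤ 0 := fun y => by rw [← SetLike.mem_coe, hs]; rfl
  have hev : ∀ᶠ δ in 𝓝[>] (0 : ℝ), ∀ φ ∈ s, φ (y + δ • d) ≤ 0 := by
    refine (Finset.eventually_all s).2 fun φ hφ => ?_
    rcases ((hmem y).1 hy φ hφ).lt_or_eq with hlt | heq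
    · have h1 : Tendsto (fun δ : ℝ => φ (y + δ • d)) (𝓝 0) (𝓝 (φ (y + (0 : ℝ) • d))) :=
        Continuous.tendsto (by fun_prop) _
      rw [zero_smul, add_zero] at h1
      exact ((h1.mono_left nhdsWithin_le_nhds).eventually (gt_mem_nhds hlt)).mono
        fun δ h => h.le
    · filter_upwards [self_mem_nhdsWithin] with δ hδ
      rw [map_add, heq, zero_add, map_smul]
      exact mul_nonpos_of_nonneg_of_nonpos (le_of_lt hδ) (hd φ hφ heq)
  obtain ⟨δ, h1, h2⟩ := (hev.and self_mem_nhdsWithin).exists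
  exact ⟨δ, h2, (hmem _).2 h1⟩

/-- Necessity for polyhedral cones. Infinitely many points of the sequence have the same active
constraints, which makes the limit multiplier complementary to them; the limit of the difference
quotients of the multipliers is lifted to `P × X` by the Farkas lemma. -/
theorem IsMultiplierSequence.exists_isReducedTangent_of_polyhedral
    {t : ℕ → ℝ} {w : ℕ → P × X} {u : ℕ → StrongDual ℝ X} {m : ℕ → StrongDual ℝ E}
    {μ : StrongDual ℝ E} (Q : IsMultiplierSequence G K z₀ xs v us t w u m μ)
    (M : IsStableReduction S G K z₀ κ U) (hK : IsPolyhedralCone K) :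
    ∃ ws, IsReducedTangent G K z₀ xs v us μ ws := by
  classical
  obtain ⟨s, hs⟩ := hK
  have hmem : ∀ y, y ∈ K ↔ ∀ φ ∈ s, φ y ≤ 0 := fun y => by rw [← SetLike.mem_coe, hs]; rfl
  have hsK : ∀ φ ∈ s, φ ∈ polarCone K := fun φ hφ y hy => (hmem y).1 hy φ hφ
  set A := fderiv ℝ G z₀ with hA
  set y : ℕ → E := fun k => G (z₀ + t k • w k) with hy
  have hAv : A v ∈ K := Q.apply_mem M
  -- Eventually the multipliers vanish at `A v`.
  have hmAv : ∀ᶠ k in atTop, m k (A v) = 0 := by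
    have h1 : ∀ᶠ k in atTop, ∀ φ ∈ s, φ ((2 : ℝ) • (t k)⁻¹ • y k - A v) ≤ 0 := by
      refine (Finset.eventually_all s).2 fun φ hφ => ?_
      rcases ((hmem _).1 hAv φ hφ).lt_or_eq with hlt | heq
      · have h2 : Tendsto (fun k => φ ((2 : ℝ) • (t k)⁻¹ • y k - A v)) atTop
            (𝓝 (φ ((2 : ℝ) • A v - A v))) :=
          (φ.continuous.tendsto _).comp (((Q.tendsto_inv_smul M).const_smul _).sub_const _)
        rw [two_smul, add_sub_cancel_right] at h2
        exact (h2.eventually (gt_mem_nhds hlt)).mono fun k h => h.le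
      · refine Eventually.of_forall fun k => ?_
        have h2 := (hmem _).1 (K.smul_mem (Q.mem k) (inv_pos.2 (Q.pos k)).le) φ hφ
        rw [map_sub, map_smul, heq, sub_zero, smul_eq_mul]
        linarith
    filter_upwards [h1] with k hk
    have h2 := Q.polar k _ ((hmem _).2 hk)
    rw [map_sub, map_smul, map_smul, Q.apply_eq_zero k, smul_zero, smul_zero] at h2
    exact le_antisymm (Q.polar k _ hAv) (by linarith)
  -- Infinitely many points share their active constraints.
  obtain ⟨I, hI⟩ : ∃ I, ∃ᶠ k in atTop, s.filter (fun φ => φ (y k) = 0) = I := by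
    by_contra hcon
    push Not at hcon
    have h1 : ∀ᶠ k in atTop, ∀ I ∈ s.powerset, s.filter (fun φ => φ (y k) = 0) ≠ I :=
      (Finset.eventually_all _).2 fun I _ => hcon I
    obtain ⟨k, hk⟩ := h1.exists
    exact hk _ (Finset.mem_powerset.2 (Finset.filter_subset _ _)) rfl
  have hμy : ∃ᶠ k in atTop, μ (y k) = 0 := by
    refine hI.mono fun k hk => ?_
    refine isClosed_singleton.mem_of_frequently_of_tendsto (hI.mono fun l hl => ?_)
      (tendsto_clm_apply Q.tendsto_m (tendsto_const_nhds (x := y k)))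
    obtain ⟨δ, hδ, h1⟩ := exists_pos_add_smul_mem hs (Q.mem l) (d := y l - y k)
      fun φ hφ h0 => by
        have h2 : φ ∈ s.filter fun φ => φ (y k) = 0 := by
          rw [hk, ← hl]; exact Finset.mem_filter.2 ⟨hφ, h0⟩
        rw [map_sub, (Finset.mem_filter.1 h2).2, sub_zero]
        exact h0.le
    have h2 := Q.polar l _ h1
    have h3 : m l (y l) = 0 := Q.apply_eq_zero l
    rw [map_add, Q.apply_eq_zero l, map_smul, map_sub, h3, zero_add, zero_sub, smul_eq_mul] at h2
    have h4 : 0 ≤ m l (y k) := by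
      by_contra hneg
      push Not at hneg
      have := mul_pos hδ (neg_pos.2 hneg)
      linarith
    exact le_antisymm (Q.polar l _ (Q.mem k)) h4
  set us' := us - (μ.comp (fderiv ℝ (fderiv ℝ G) z₀ v)).comp (ContinuousLinearMap.inr ℝ P X)
    with hus'
  -- The equality constraint `μ (A w) = 0` is encoded by the two functionals `μ` and `-μ`.
  set T : Finset (StrongDual ℝ E) := s.filter (fun φ => φ (A v) = 0) ∪ {μ, -μ} with hT
  obtain ⟨a, ha, hsum⟩ := exists_nonneg_combination T
    (fun φ => (φ.comp (A.comp (ContinuousLinearMap.inr ℝ P X))).toLinearMap) us'.toLinearMap (by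
      intro x hx
      set z : P × X := (0, x) with hz
      have hx' : ∀ φ ∈ T, φ (A z) ≤ 0 := fun φ hφ => by simpa using! hx φ hφ
      have hμ0 : μ (A z) = 0 := by
        have h1 := hx' μ (by simp [hT])
        have h2 := hx' (-μ) (by simp [hT])
        rw [neg_apply] at h2
        linarith
      obtain ⟨δ, hδ, hmemδ⟩ := exists_pos_add_smul_mem hs hAv (d := A z)
        fun φ hφ h0 => hx' φ (Finset.mem_union_left _ (Finset.mem_filter.2 ⟨hφ, h0⟩))
      refine le_of_tendsto (tendsto_clm_apply (Q.tendsto_quotient M)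
        (tendsto_const_nhds (x := x))) (hmAv.mono fun k hk => ?_)
      have h1 := Q.polar k _ hmemδ
      rw [map_add, hk, zero_add, map_smul, smul_eq_mul] at h1
      have h2 : m k (A z) ≤ 0 := by
        by_contra hneg
        push Not at hneg
        have := mul_pos hδ hneg
        linarith
      have h3 : (t k)⁻¹ * (m k (A z) - μ (A z)) ≤ 0 :=
        mul_nonpos_of_nonneg_of_nonpos (inv_pos.2 (Q.pos k)).le (by linarith)
      simpa using! h3)
  set η : StrongDual ℝ E := ∑ φ ∈ T, a φ • φ with hη
  have hη' : ∀ e, η e = ∑ φ ∈ T, a φ * φ e := fun e => by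
    rw [hη, sum_apply]
    rfl
  have hT' : ∀ φ ∈ T, (∀ w', A w' ∈ K → μ (A w') = 0 → φ (A w') ≤ 0) ∧ φ (A v) = 0 := by
    intro φ hφ
    rcases Finset.mem_union.1 hφ with hφ | hφ
    · exact ⟨fun w' h _ => hsK φ (Finset.mem_filter.1 hφ).1 _ h, (Finset.mem_filter.1 hφ).2⟩
    · have hμv : μ (A v) = 0 := Q.apply_limit_eq_zero M
      rcases Finset.mem_insert.1 hφ with rfl | hφ
      · exact ⟨fun w' _ h => h.le, hμv⟩
      · rw [Finset.mem_singleton.1 hφ]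
        exact ⟨fun w' _ h => by simp [h], by simp [hμv]⟩
  refine ⟨η.comp A,
    { mem := hAv
      polar := Q.polar_limit
      apply_eq_zero := Q.apply_limit_eq_zero M
      comp_eq := Q.comp_limit_eq M
      maximal := fun μ' h1 h2 => Q.le_of_frequently M (fun ε hε => hμy.mono fun k hk => ?_) h1 h2
      normal_nonpos := fun w' h1 h2 => ?_
      normal_apply := ?_
      eq := ?_ }⟩
  · rw [show μ (G (z₀ + t k • w k)) = 0 from hk, mul_zero]
    linarith
  · rw [ContinuousLinearMap.comp_apply, hη']
    exact Finset.sum_nonpos fun φ hφ =>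
      mul_nonpos_of_nonneg_of_nonpos (ha φ hφ) ((hT' φ hφ).1 w' h1 h2)
  · rw [ContinuousLinearMap.comp_apply, hη']
    exact Finset.sum_eq_zero fun φ hφ => by rw [(hT' φ hφ).2, mul_zero]
  · have h1 : us' = (η.comp A).comp (ContinuousLinearMap.inr ℝ P X) := by
      ext x
      have h2 := LinearMap.congr_fun hsum x
      rw [LinearMap.sum_apply] at h2
      rw [ContinuousLinearMap.comp_apply, ContinuousLinearMap.comp_apply, hη']
      exact h2
    rw [← h1, hus', add_sub_cancel]

end Necessity

/-! ### Tangents to the graph: sufficiency -/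

section Sufficiency

/-- A finite-dimensional space carries a Euclidean structure whose norm dominates the given one. -/
lemma exists_symm_bilin_ge_sq_norm (Z : Type*) [NormedAddCommGroup Z] [NormedSpace ℝ Z]
    [FiniteDimensional ℝ Z] :
    ∃ q : Z →L[ℝ] Z →L[ℝ] ℝ, (∀ a b, q a b = q b a) ∧ ∀ a, ‖a‖ ^ 2 ≤ q a a := by
  let e : Z ≃L[ℝ] EuclideanSpace ℝ (Fin (Module.finrank ℝ Z)) := toEuclidean
  let e' := (e : Z →L[ℝ] EuclideanSpace ℝ (Fin (Module.finrank ℝ Z)))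
  let c : ℝ := ‖(e.symm : EuclideanSpace ℝ (Fin (Module.finrank ℝ Z)) →L[ℝ] Z)‖ ^ 2
  let q : Z →L[ℝ] Z →L[ℝ] ℝ := c • (isBoundedBilinearMap_inner (𝕜 := ℝ)
    (E := EuclideanSpace ℝ (Fin (Module.finrank ℝ Z)))).toContinuousLinearMap.bilinearComp e' e'
  have hq : ∀ a b, q a b = c * inner ℝ (e a) (e b) := fun a b => rfl
  refine ⟨q, fun a b => by rw [hq, hq, real_inner_comm], fun a => ?_⟩
  rw [hq, real_inner_self_eq_norm_sq, ← mul_pow]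
  refine pow_le_pow_left₀ (norm_nonneg _) ?_ 2
  simpa using (e.symm : EuclideanSpace ℝ (Fin (Module.finrank ℝ Z)) →L[ℝ] Z).le_opNorm (e a)

variable {P X E : Type*} [NormedAddCommGroup P] [NormedSpace ℝ P]
  [NormedAddCommGroup X] [NormedSpace ℝ X]
  [NormedAddCommGroup E] [InnerProductSpace ℝ E]

variable {S : Set (P × X)} {G : P × X → E} {K : ProperCone ℝ E} {z₀ : P × X} {κ : ℝ}
  {U : Set (P × X)} {xs : StrongDual ℝ X} {v : P × X} {us : StrongDual ℝ X} {μ : StrongDual ℝ E}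
  {ws : StrongDual ℝ (P × X)} {q : (P × X) →L[ℝ] (P × X) →L[ℝ] ℝ}

/-- Recovery sequences: along any steps `t k ↓ 0` there are points of `S` in directions converging
to `v` at which the linear functional `μ ∘ A` attains its best second-order value up to `ε`. The
second-order correction comes from conic duality, since `μ` is optimal, and the error bound moves
the corrected points into `S`. -/
theorem exists_recovery [FiniteDimensional ℝ E] [FiniteDimensional ℝ P] [FiniteDimensional ℝ X]
    (M : IsStableReduction S G K z₀ κ U) (H : IsReducedTangent G K z₀ xs v us μ ws)
    {t : ℕ → ℝ} (ht : ∀ k, 0 < t k) (ht0 : Tendsto t atTop (𝓝 0)) {ε : ℝ} (hε : 0 < ε) :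
    ∃ y : ℕ → P × X, Tendsto y atTop (𝓝 v) ∧ ∀ᶠ k in atTop, z₀ + t k • y k ∈ S ∧
      -((t k)⁻¹ * μ (fderiv ℝ G z₀ (y k))) ≤
        1 / 2 * (μ (fderiv ℝ (fderiv ℝ G) z₀ v v) + ε) := by
  set A := fderiv ℝ G z₀ with hA
  set b := fderiv ℝ (fderiv ℝ G) z₀ v v with hb
  set zs : StrongDual ℝ (P × X) := μ.comp A with hzs
  have hL : 0 ≤ κ * ‖zs‖ := mul_nonneg M.nonneg (norm_nonneg _)
  -- Maximality of `μ` excludes a dual solution with value `μ b + ε`, so the primal penalty problem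
  -- has a point `r` with smaller value. It is the second-order correction of the direction `v`.
  obtain ⟨r, hr⟩ : ∃ r, κ * ‖zs‖ * Metric.infDist (A r + b) K < zs r + (μ b + ε) := by
    by_contra hcon
    push Not at hcon
    obtain ⟨ν, hν, -, h1, h2⟩ := exists_mem_polarCone_of_le_infDist K A b hL zs hcon
    have := H.maximal ν hν h1
    linarith
  set d := Metric.infDist (A r + b) K with hd
  let vk : ℕ → P × X := fun k => v + (t k / 2) • r
  have hvk : Tendsto vk atTop (𝓝 v) := by
    have h1 : Tendsto (fun k => t k / 2) atTop (𝓝 0) := by simpa using ht0.div_const 2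
    simpa using! (h1.smul_const r).const_add v
  let e : ℕ → E := fun k => (t k ^ 2)⁻¹ • (G (z₀ + t k • vk k) - G z₀ - t k • A (vk k))
  have he : Tendsto e atTop (𝓝 ((1 / 2 : ℝ) • b)) :=
    tendsto_taylor_two (M.contDiffAt z₀ M.mem) ht ht0 hvk
  have hη : Tendsto (fun k => ‖e k - (1 / 2 : ℝ) • b‖) atTop (𝓝 0) :=
    tendsto_iff_norm_sub_tendsto_zero.1 he
  have hdist : ∀ k, Metric.infDist (G (z₀ + t k • vk k)) K ≤
      t k ^ 2 * (1 / 2 * d + ‖e k - (1 / 2 : ℝ) • b‖) := by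
    intro k
    have hne := (ht k).ne'
    have h1 : G (z₀ + t k • vk k) = t k • A v +
        t k ^ 2 • ((1 / 2 : ℝ) • (A r + b) + (e k - (1 / 2 : ℝ) • b)) := by
      have h2 : t k ^ 2 • e k = G (z₀ + t k • vk k) - t k • A (vk k) := by
        simp only [e, M.map_zero, sub_zero, smul_smul]
        rw [mul_inv_cancel₀ (pow_ne_zero 2 hne), one_smul]
      have h3 : A (vk k) = A v + (t k / 2) • A r := by simp only [vk, map_add, map_smul]
      have h4 : G (z₀ + t k • vk k) = t k • A (vk k) + t k ^ 2 • e k := by rw [h2]; abel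
      rw [h4, h3]
      module
    rw [h1]
    refine (infDist_add_le K _ (K.smul_mem H.mem (ht k).le)).trans
      ((infDist_smul_le K _ (sq_nonneg _)).trans (mul_le_mul_of_nonneg_left ?_ (sq_nonneg _)))
    refine (infDist_le_add_norm_sub K _ ((1 / 2 : ℝ) • (A r + b))).trans ?_
    rw [add_sub_cancel_left]
    exact add_le_add (infDist_smul_le K _ (by norm_num)) le_rfl
  have hev : ∀ᶠ k in atTop, z₀ + t k • vk k ∈ U :=
    (tendsto_add_smul ht0 hvk).eventually (M.mem_nhds M.mem)
  have hy : ∀ k, ∃ y, z₀ + t k • vk k ∈ U → z₀ + t k • y ∈ S ∧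
      ‖y - vk k‖ ≤ κ * (t k * (1 / 2 * d + ‖e k - (1 / 2 : ℝ) • b‖)) := by
    intro k
    by_cases hkU : z₀ + t k • vk k ∈ U
    · obtain ⟨z', hz', hn⟩ := M.exists_near hkU
      have hne := (ht k).ne'
      refine ⟨(t k)⁻¹ • (z' - z₀), fun _ => ⟨by
        rwa [smul_smul, mul_inv_cancel₀ hne, one_smul, add_sub_cancel], ?_⟩⟩
      have e1 : (t k)⁻¹ • (z' - z₀) - vk k = (t k)⁻¹ • (z' - (z₀ + t k • vk k)) := by
        simp only [smul_sub, smul_add, smul_smul, inv_mul_cancel₀ hne, one_smul]; abel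
      rw [e1, norm_smul, Real.norm_of_nonneg (inv_pos.2 (ht k)).le, inv_mul_le_iff₀ (ht k)]
      refine (hn.trans (mul_le_mul_of_nonneg_left (hdist k) M.nonneg)).trans_eq ?_
      ring
    · exact ⟨0, fun h => absurd h hkU⟩
  choose y hy using hy
  refine ⟨y, ?_, ?_⟩
  · have h1 : Tendsto (fun k => κ * (t k * (1 / 2 * d + ‖e k - (1 / 2 : ℝ) • b‖))) atTop (𝓝 0) := by
      simpa using! (ht0.mul (hη.const_add (1 / 2 * d))).const_mul κ
    have h2 : Tendsto (fun k => y k - vk k) atTop (𝓝 0) :=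
      squeeze_zero_norm' (hev.mono fun k hk => (hy k hk).2) h1
    simpa using! h2.add hvk
  · have h1 : Tendsto (fun k => κ * ‖zs‖ * d - zs r + 2 * (κ * ‖zs‖) *
        ‖e k - (1 / 2 : ℝ) • b‖) atTop (𝓝 (κ * ‖zs‖ * d - zs r)) := by
      simpa using! (hη.const_mul (2 * (κ * ‖zs‖))).const_add (κ * ‖zs‖ * d - zs r)
    filter_upwards [hev, h1.eventually (gt_mem_nhds (show _ < μ b + ε by linarith))] with k hk hlt
    refine ⟨(hy k hk).1, ?_⟩
    have h2 : -zs (y k - vk k) ≤ ‖zs‖ * (κ * (t k * (1 / 2 * d + ‖e k - (1 / 2 : ℝ) • b‖))) :=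
      (neg_le_abs _).trans ((zs.le_opNorm _).trans
        (mul_le_mul_of_nonneg_left (hy k hk).2 (norm_nonneg _)))
    have h3 : zs v = 0 := H.apply_eq_zero
    have h4 : zs (vk k) = t k / 2 * zs r := by
      simp only [vk, map_add, map_smul, h3, zero_add, smul_eq_mul]
    rw [map_sub, h4] at h2
    have h5 : μ (A (y k)) = zs (y k) := rfl
    rw [h5, ← mul_neg, inv_mul_le_iff₀ (ht k)]
    have h6 := mul_le_mul_of_nonneg_left hlt.le (half_pos (ht k)).le
    linarith

/-- The objective, in scaled variables, whose constrained minimizers approximate the direction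
`v`: a tilt by `zs` and `vs`, and the quadratic penalty of the form `q` with parameter `ρ`. -/
def scaledObjective (q : (P × X) →L[ℝ] (P × X) →L[ℝ] ℝ) (zs vs : StrongDual ℝ (P × X))
    (ρ : ℝ) (v : P × X) (t : ℝ) (w : P × X) : ℝ :=
  -(t⁻¹ * zs w) - vs w + ρ / 2 * q (w - v) (w - v)

/-- Cluster points of minimizers of the scaled objective are equal to `v`: recovery sequences bound
the minimal values from above, the second-order expansion of `⟨μ, G⟩` bounds them from below, and
for large `ρ` the resulting inequality is strict away from `v`. -/
theorem eq_of_tendsto_minimizers [FiniteDimensional ℝ E] [FiniteDimensional ℝ P]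
    [FiniteDimensional ℝ X] (M : IsStableReduction S G K z₀ κ U)
    (H : IsReducedTangent G K z₀ xs v us μ ws) {ρ : ℝ}
    (hρ : ∀ d, ‖d‖ ^ 2 ≤ 1 / 2 * μ (fderiv ℝ (fderiv ℝ G) z₀ d d) + ρ / 2 * q d d)
    {t : ℕ → ℝ} (ht : ∀ k, 0 < t k) (ht0 : Tendsto t atTop (𝓝 0)) {w : ℕ → P × X} {w₀ : P × X}
    (hw : Tendsto w atTop (𝓝 w₀)) (hwS : ∀ k, z₀ + t k • w k ∈ S)
    (hmin : ∀ k, ∀ y, ‖y - v‖ ≤ 1 → z₀ + t k • y ∈ S →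
      scaledObjective q (μ.comp (fderiv ℝ G z₀)) (μ.comp (fderiv ℝ (fderiv ℝ G) z₀ v) + ws) ρ v
        (t k) (w k) ≤
      scaledObjective q (μ.comp (fderiv ℝ G z₀)) (μ.comp (fderiv ℝ (fderiv ℝ G) z₀ v) + ws) ρ v
        (t k) y) : w₀ = v := by
  set A := fderiv ℝ G z₀ with hA
  set D := fderiv ℝ (fderiv ℝ G) z₀ with hD
  set vs : StrongDual ℝ (P × X) := μ.comp (D v) + ws with hvs
  set qv : P × X → ℝ := fun z => q (z - v) (z - v) with hqv
  have hqc : Continuous qv := by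
    have h1 : Continuous fun z : P × X => z - v := by fun_prop
    exact (q.continuous.comp h1).clm_apply h1
  have hup : ∀ ε : ℝ, 0 < ε → ∃ r : ℕ → ℝ, Tendsto r atTop
      (𝓝 (1 / 2 * (μ (D v v) + ε) - vs v + vs w₀ - ρ / 2 * qv w₀)) ∧
      ∀ᶠ k in atTop, -((t k)⁻¹ * μ (A (w k))) ≤ r k := by
    intro ε hε
    obtain ⟨y, hy, hyS⟩ := exists_recovery M H ht ht0 hε
    refine ⟨fun k => 1 / 2 * (μ (D v v) + ε) - vs (y k) + ρ / 2 * qv (y k) + vs (w k) -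
      ρ / 2 * qv (w k), ?_, ?_⟩
    · have h1 := ((((vs.continuous.tendsto v).comp hy).const_sub (1 / 2 * (μ (D v v) + ε))).add
        (((hqc.tendsto v).comp hy).const_mul (ρ / 2))).add ((vs.continuous.tendsto w₀).comp hw)
      have h2 := h1.sub (((hqc.tendsto w₀).comp hw).const_mul (ρ / 2))
      have h3 : qv v = 0 := by simp [hqv]
      rw [h3, mul_zero, add_zero] at h2
      exact h2
    · have h1 : ∀ᶠ k in atTop, ‖y k - v‖ < 1 := by
        have := tendsto_iff_norm_sub_tendsto_zero.1 hy
        exact this.eventually (gt_mem_nhds one_pos)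
      filter_upwards [hyS, h1] with k hk hk1
      have h2 := hmin k (y k) hk1.le hk.1
      simp only [scaledObjective, ContinuousLinearMap.comp_apply] at h2
      have h3 := hk.2
      simp only [hqv]
      linarith
  have hlow : Tendsto (fun k => μ ((t k ^ 2)⁻¹ • (G (z₀ + t k • w k) - G z₀ - t k • A (w k))))
      atTop (𝓝 (μ ((1 / 2 : ℝ) • D w₀ w₀))) :=
    (μ.continuous.tendsto _).comp (tendsto_taylor_two (M.contDiffAt z₀ M.mem) ht ht0 hw)
  have hlow' : ∀ᶠ k in atTop,
      μ ((t k ^ 2)⁻¹ • (G (z₀ + t k • w k) - G z₀ - t k • A (w k))) ≤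
        -((t k)⁻¹ * μ (A (w k))) := by
    filter_upwards [(tendsto_add_smul ht0 hw).eventually (M.mem_nhds M.mem)] with k hkU
    have hne := (ht k).ne'
    have h1 : (t k ^ 2)⁻¹ * μ (G (z₀ + t k • w k)) ≤ 0 := mul_nonpos_of_nonneg_of_nonpos
      (by positivity) (H.polar _ ((M.mem_iff _ hkU).1 (hwS k)))
    have h2 : (t k ^ 2)⁻¹ * (t k * μ (A (w k))) = (t k)⁻¹ * μ (A (w k)) := by field_simp
    rw [M.map_zero, sub_zero, map_smul, map_sub, map_smul, smul_eq_mul, smul_eq_mul, mul_sub, h2]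
    linarith
  have hineq : μ ((1 / 2 : ℝ) • D w₀ w₀) ≤
      1 / 2 * μ (D v v) - vs v + vs w₀ - ρ / 2 * qv w₀ := by
    refine le_of_forall_pos_le_add fun ε hε => ?_
    obtain ⟨r, hr, hle⟩ := hup ε hε
    have := le_of_tendsto_of_tendsto hlow hr (by
      filter_upwards [hlow', hle] with k h1 h2 using h1.trans h2)
    linarith
  -- The cluster point belongs to the critical cone.
  have hAw : A w₀ ∈ K := M.map_tendsto_mem ht ht0 hw (Eventually.of_forall hwS)
  have hμAw : μ (A w₀) = 0 := by
    refine le_antisymm (H.polar _ hAw) ?_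
    obtain ⟨r, hr, hle⟩ := hup 1 one_pos
    have h1 : Tendsto (fun k => -μ (A (w k))) atTop (𝓝 (-μ (A w₀))) :=
      ((((μ.comp A).continuous.tendsto w₀).comp hw)).neg
    have h2 := ht0.mul hr
    rw [zero_mul] at h2
    have := le_of_tendsto_of_tendsto h1 h2 (by
      filter_upwards [hle] with k hk
      have := mul_le_mul_of_nonneg_left hk (ht k).le
      rwa [mul_neg, mul_inv_cancel_left₀ (ht k).ne'] at this)
    linarith
  have hws : ws w₀ ≤ 0 := H.normal_nonpos w₀ hAw hμAw
  have hsymm : D (w₀ - v) v = D v (w₀ - v) :=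
    ((M.contDiffAt z₀ M.mem).isSymmSndFDerivAt (by simp)) _ _
  have h1 : μ (D w₀ w₀) = μ (D v v) + 2 * μ (D v (w₀ - v)) + μ (D (w₀ - v) (w₀ - v)) := by
    have h2 : D w₀ w₀ = D v v + D v (w₀ - v) + D (w₀ - v) v + D (w₀ - v) (w₀ - v) := by
      simp only [map_sub, sub_apply]; abel
    rw [h2, hsymm]
    simp only [map_add]
    ring
  have h2 : vs w₀ - vs v = μ (D v (w₀ - v)) + ws w₀ := by
    have h3 := H.normal_apply
    simp only [hvs, add_apply, ContinuousLinearMap.comp_apply, map_sub, h3]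
    ring
  have h3 := hρ (w₀ - v)
  have h4 : ρ / 2 * qv w₀ = ρ / 2 * q (w₀ - v) (w₀ - v) := rfl
  rw [map_smul, smul_eq_mul] at hineq
  have h5 : ‖w₀ - v‖ ^ 2 ≤ 0 := by linarith
  exact sub_eq_zero.1 (norm_eq_zero.1 (pow_eq_zero_iff two_ne_zero |>.1
    (le_antisymm h5 (sq_nonneg _))))

/-- An interior minimizer of the scaled objective yields a regular normal to `S`. -/
lemma mem_regularNormalCone_of_minimizer (hq : ∀ a b, q a b = q b a)
    {zs vs : StrongDual ℝ (P × X)} {ρ t : ℝ} (ht : 0 < t)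
    {w : P × X} (hwS : z₀ + t • w ∈ S) (hw : ‖w - v‖ < 1)
    (hmin : ∀ y, ‖y - v‖ ≤ 1 → z₀ + t • y ∈ S →
      scaledObjective q zs vs ρ v t w ≤ scaledObjective q zs vs ρ v t y) :
    zs + t • (vs - ρ • q (w - v)) ∈ regularNormalCone S (z₀ + t • w) := by
  have hne := ht.ne'
  let c : P × X → P × X := fun z => t⁻¹ • (z - z₀)
  have hcw : c (z₀ + t • w) = w := by
    simp only [c, add_sub_cancel_left, smul_smul, inv_mul_cancel₀ hne, one_smul]
  have hcz : ∀ z, z₀ + t • c z = z := fun z => by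
    simp only [c, smul_smul, mul_inv_cancel₀ hne, one_smul, add_sub_cancel]
  have hc : ∀ z, HasFDerivAt c (t⁻¹ • ContinuousLinearMap.id ℝ (P × X)) z := fun z =>
    ((hasFDerivAt_id z).sub_const z₀).const_smul t⁻¹
  have hobj : HasFDerivAt (scaledObjective q zs vs ρ v t)
      (-(t⁻¹ • zs) - vs + ρ • q (w - v)) w := by
    have h1 : HasFDerivAt (fun z : P × X => z - v) (ContinuousLinearMap.id ℝ (P × X)) w :=
      (hasFDerivAt_id w).sub_const v
    have h2 : HasFDerivAt (fun z : P × X => q (z - v)) q w :=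
      q.hasFDerivAt.comp w h1
    have h3 := ((zs.hasFDerivAt (x := w)).const_mul t⁻¹).neg.sub (vs.hasFDerivAt (x := w))
    refine (h3.add ((h2.clm_apply h1).const_mul (ρ / 2))).congr_fderiv ?_
    refine ContinuousLinearMap.ext fun y => ?_
    have h4 := hq y (w - v)
    simp only [add_apply, sub_apply, neg_apply, smul_apply, ContinuousLinearMap.comp_apply,
      ContinuousLinearMap.flip_apply, ContinuousLinearMap.id_apply, smul_eq_mul, h4]
    ring
  have hf : HasFDerivAt (fun z => t ^ 2 * scaledObjective q zs vs ρ v t (c z))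
      (-(zs + t • (vs - ρ • q (w - v)))) (z₀ + t • w) := by
    have h1 := (HasFDerivAt.comp (z₀ + t • w) (g := scaledObjective q zs vs ρ v t)
      (by rw [hcw]; exact hobj) (hc _)).const_mul (t ^ 2)
    refine h1.congr_fderiv (ContinuousLinearMap.ext fun y => ?_)
    simp only [add_apply, sub_apply, neg_apply, smul_apply, ContinuousLinearMap.comp_apply,
      ContinuousLinearMap.id_apply, smul_eq_mul, map_smul]
    field_simp
    ring
  have hloc : IsLocalMinOn (fun z => t ^ 2 * scaledObjective q zs vs ρ v t (c z)) S
      (z₀ + t • w) := by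
    have h1 : ∀ᶠ z in 𝓝 (z₀ + t • w), ‖c z - v‖ < 1 := by
      have h2 : ContinuousAt (fun z => ‖c z - v‖) (z₀ + t • w) :=
        ((hc _).continuousAt.sub continuousAt_const).norm
      exact h2.eventually (gt_mem_nhds (show ‖c (z₀ + t • w) - v‖ < 1 by rwa [hcw]))
    filter_upwards [nhdsWithin_le_nhds h1, self_mem_nhdsWithin] with z hz hzS
    rw [hcw]
    exact mul_le_mul_of_nonneg_left (hmin _ hz.le (by rwa [hcz])) (sq_nonneg t)
  have := neg_mem_regularNormalCone_of_isLocalMinOn hf hwS hloc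
  rwa [neg_neg] at this

/-- Every reduced tangent is realized by a sequence in the graph of the normal cone mapping. -/
theorem exists_sequence_of_isReducedTangent [FiniteDimensional ℝ E] [FiniteDimensional ℝ P]
    [FiniteDimensional ℝ X] (M : IsStableReduction S G K z₀ κ U)
    (H : IsReducedTangent G K z₀ xs v us μ ws) :
    ∃ (t : ℕ → ℝ) (w : ℕ → P × X) (u : ℕ → StrongDual ℝ X), (∀ k, 0 < t k) ∧
      Tendsto t atTop (𝓝 0) ∧ Tendsto w atTop (𝓝 v) ∧ Tendsto u atTop (𝓝 us) ∧
      ∀ k, xs + t k • u k ∈ normalCone {x | ((z₀ + t k • w k).1, x) ∈ S} (z₀ + t k • w k).2 := by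
  set A := fderiv ℝ G z₀ with hA
  set D := fderiv ℝ (fderiv ℝ G) z₀ with hD
  set vs : StrongDual ℝ (P × X) := μ.comp (D v) + ws with hvs
  obtain ⟨q, hq, hq2⟩ := exists_symm_bilin_ge_sq_norm (P × X)
  -- This `ρ` dominates the possibly negative curvature of `⟨μ, G⟩`.
  set ρ : ℝ := ‖μ‖ * ‖D‖ + 2 with hρ_def
  have hρ : ∀ d, ‖d‖ ^ 2 ≤ 1 / 2 * μ (D d d) + ρ / 2 * q d d := by
    intro d
    have h1 : -μ (D d d) ≤ ‖μ‖ * ‖D‖ * ‖d‖ ^ 2 := by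
      refine (neg_le_abs _).trans ((μ.le_opNorm _).trans ?_)
      rw [mul_assoc]
      refine mul_le_mul_of_nonneg_left ((D.le_opNorm₂ d d).trans_eq (by ring)) (norm_nonneg _)
    have h2 := mul_le_mul_of_nonneg_left (hq2 d)
      (show 0 ≤ ρ / 2 by positivity)
    have h3 : ρ / 2 * ‖d‖ ^ 2 = 1 / 2 * (‖μ‖ * ‖D‖ * ‖d‖ ^ 2) + ‖d‖ ^ 2 := by rw [hρ_def]; ring
    linarith
  set t : ℕ → ℝ := fun k => 1 / ((k : ℝ) + 1) with ht_def
  have ht : ∀ k, 0 < t k := fun k => Nat.one_div_pos_of_nat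
  have ht0 : Tendsto t atTop (𝓝 0) := tendsto_one_div_add_atTop_nhds_zero_nat
  -- Existence of minimizers over the part of `S` in the ball of radius `t k` about `z₀ + t k • v`.
  have hexists : ∀ᶠ k in atTop, ∃ w, ‖w - v‖ ≤ 1 ∧ z₀ + t k • w ∈ S ∧
      ∀ y, ‖y - v‖ ≤ 1 → z₀ + t k • y ∈ S →
        scaledObjective q (μ.comp A) vs ρ v (t k) w ≤
          scaledObjective q (μ.comp A) vs ρ v (t k) y := by
    obtain ⟨y, hy, hyS⟩ := exists_recovery M H ht ht0 one_pos
    have hy1 : ∀ᶠ k in atTop, ‖y k - v‖ < 1 :=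
      (tendsto_iff_norm_sub_tendsto_zero.1 hy).eventually (gt_mem_nhds one_pos)
    obtain ⟨δ, hδ, hball⟩ := Metric.mem_nhds_iff.1 (M.mem_nhds M.mem)
    have hsmall : ∀ᶠ k in atTop, t k * (‖v‖ + 1) < δ := by
      have h1 := ht0.mul_const (‖v‖ + 1)
      rw [zero_mul] at h1
      exact h1.eventually (gt_mem_nhds hδ)
    filter_upwards [hyS, hy1, hsmall] with k hk1 hk2 hk3
    have hU : ∀ w, w ∈ Metric.closedBall v 1 → z₀ + t k • w ∈ U := by
      intro w hw
      refine hball ?_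
      rw [mem_ball_iff_norm, add_sub_cancel_left, norm_smul, Real.norm_of_nonneg (ht k).le]
      refine lt_of_le_of_lt (mul_le_mul_of_nonneg_left ?_ (ht k).le) hk3
      have := norm_add_le (w - v) v
      rw [sub_add_cancel] at this
      rw [mem_closedBall_iff_norm] at hw
      linarith
    have hcont : Continuous fun w : P × X => z₀ + t k • w := by fun_prop
    have hclosed : IsClosed (Metric.closedBall v 1 ∩ (fun w => G (z₀ + t k • w)) ⁻¹' K) :=
      ContinuousOn.preimage_isClosed_of_isClosed (fun w hw =>
        (ContinuousAt.comp (f := fun w => z₀ + t k • w) (M.hasFDerivAt (hU w hw)).continuousAt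
          hcont.continuousAt).continuousWithinAt) Metric.isClosed_closedBall K.isClosed
    have hcompact := (isCompact_closedBall v (1 : ℝ)).of_isClosed_subset hclosed inter_subset_left
    have hobjc : Continuous (scaledObjective q (μ.comp A) vs ρ v (t k)) := by
      have h1 : Continuous fun z : P × X => z - v := by fun_prop
      have h2 := (q.continuous.comp h1).clm_apply h1
      exact ((((μ.comp A).continuous.const_mul _).neg).sub vs.continuous).add (h2.const_mul _)
    have hmem : ∀ w, ‖w - v‖ ≤ 1 → (z₀ + t k • w ∈ S ↔
        w ∈ Metric.closedBall v 1 ∩ (fun w => G (z₀ + t k • w)) ⁻¹' K) := by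
      intro w hw
      have hw' : w ∈ Metric.closedBall v 1 := by rwa [mem_closedBall_iff_norm]
      rw [M.mem_iff _ (hU w hw')]
      exact ⟨fun h => ⟨hw', h⟩, fun h => h.2⟩
    obtain ⟨w, hw, hmin⟩ := hcompact.exists_isMinOn ⟨y k, (hmem _ hk2.le).1 hk1.1⟩
      hobjc.continuousOn
    have hw1 : ‖w - v‖ ≤ 1 := by rw [← mem_closedBall_iff_norm]; exact hw.1
    exact ⟨w, hw1, (hmem w hw1).2 hw, fun y' h1 h2 => hmin ((hmem y' h1).1 h2)⟩
  obtain ⟨N, hN⟩ := eventually_atTop.1 hexists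
  choose w hw1 hwS hwmin using fun k => hN (k + N) (by omega)
  have hb : ∀ k, w k ∈ Metric.closedBall v 1 := fun k => by
    rw [mem_closedBall_iff_norm]; exact hw1 k
  obtain ⟨w₀, -, φ, hφ, hlim⟩ := tendsto_subseq_of_bounded Metric.isBounded_closedBall hb
  have htφ : Tendsto (fun k => t (φ k + N)) atTop (𝓝 0) :=
    ht0.comp ((tendsto_add_atTop_nat N).comp hφ.tendsto_atTop)
  obtain rfl : w₀ = v := eq_of_tendsto_minimizers M H hρ (fun k => ht (φ k + N)) htφ hlim
    (fun k => hwS (φ k)) fun k => hwmin (φ k)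
  have hev1 : ∀ᶠ k in atTop, ‖w (φ k) - w₀‖ < 1 :=
    (tendsto_iff_norm_sub_tendsto_zero.1 hlim).eventually (gt_mem_nhds one_pos)
  have hev2 : ∀ᶠ k in atTop, z₀ + t (φ k + N) • w (φ k) ∈ U :=
    (tendsto_add_smul htφ hlim).eventually (M.mem_nhds M.mem)
  obtain ⟨N', hN'⟩ := eventually_atTop.1 (hev1.and hev2)
  have hshift : Tendsto (fun k => k + N') atTop atTop := tendsto_add_atTop_nat N'
  refine ⟨fun k => t (φ (k + N') + N), fun k => w (φ (k + N')), fun k =>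
    (vs - ρ • q (w (φ (k + N')) - w₀)).comp (ContinuousLinearMap.inr ℝ P X),
    fun k => ht _, htφ.comp hshift, hlim.comp hshift, ?_, fun k => ?_⟩
  · have h1 : Tendsto (fun k => w (φ (k + N')) - w₀) atTop (𝓝 0) := by
      simpa using! (hlim.comp hshift).sub_const w₀
    have h2 : Tendsto (fun k => vs - ρ • q (w (φ (k + N')) - w₀)) atTop (𝓝 vs) := by
      simpa using! (((q.continuous.tendsto 0).comp h1).const_smul ρ).const_sub vs
    have h3 := tendsto_clm_comp h2 (tendsto_const_nhds (x := ContinuousLinearMap.inr ℝ P X))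
    rw [H.eq]
    exact h3
  · obtain ⟨h1, h2⟩ := hN' (k + N') (by omega)
    have h3 := mem_regularNormalCone_of_minimizer hq (ht (φ (k + N') + N)) (hwS (φ (k + N'))) h1
      (hwmin (φ (k + N')))
    obtain ⟨ν, hν, h4, h5⟩ := M.exists_multiplier h2 h3
    have h6 := M.comp_mem_normalCone_section h2 (hwS _) hν h5
    rw [← ContinuousLinearMap.comp_assoc, h4] at h6
    have h7 : ∀ θ : StrongDual ℝ (P × X), ∀ s : ℝ,
        (μ.comp A + s • θ).comp (ContinuousLinearMap.inr ℝ P X) =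
          xs + s • θ.comp (ContinuousLinearMap.inr ℝ P X) := by
      intro θ s
      rw [← H.comp_eq]
      rfl
    rw [h7] at h6
    exact h6

end Sufficiency

/-! ### Reducible sets -/

lemma IsC2ConeReduction.contDiffAt {Y E : Type*} [NormedAddCommGroup Y] [NormedSpace ℝ Y]
    [NormedAddCommGroup E] [InnerProductSpace ℝ E] {C : Set Y} {y₀ : Y} {h : Y → E}
    {K : ProperCone ℝ E} (hC : IsC2ConeReduction C y₀ h K) : ContDiffAt ℝ 2 h y₀ := by
  obtain ⟨V, hV, hy₀, hh, -⟩ := hC.exists_nhd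
  exact hh.contDiffAt (hV.mem_nhds hy₀)

section Reducible

variable {Y E : Type*} [NormedAddCommGroup Y] [NormedSpace ℝ Y] [FiniteDimensional ℝ Y]
  [NormedAddCommGroup E] [InnerProductSpace ℝ E] [FiniteDimensional ℝ E]
  {C : Set Y} {y₀ : Y} {h : Y → E} {K : ProperCone ℝ E}

/-- A mapping with surjective derivative is metrically regular, so that the distance to a
`C²`-reducible set is bounded by the distance of the image to the cone. -/
lemma IsC2ConeReduction.exists_error_bound (hC : IsC2ConeReduction C y₀ h K) :
    ∃ (c : ℝ) (V : Set Y), 0 ≤ c ∧ IsOpen V ∧ y₀ ∈ V ∧ (∀ y ∈ V, ContDiffAt ℝ 2 h y) ∧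
      (∀ y ∈ V, (y ∈ C ↔ h y ∈ K)) ∧
      ∀ y ∈ V, ∃ y' ∈ C, ‖y' - y‖ ≤ c * Metric.infDist (h y) K := by
  obtain ⟨V, hV, hy₀, hh, hCV⟩ := hC.exists_nhd
  have hcd : ∀ y ∈ V, ContDiffAt ℝ 2 h y := fun y hy => hh.contDiffAt (hV.mem_nhds hy)
  have hmem : ∀ y ∈ V, (y ∈ C ↔ h y ∈ K) := fun y hy =>
    ⟨fun h1 => ((Set.ext_iff.1 hCV y).1 ⟨h1, hy⟩).2,
      fun h1 => ((Set.ext_iff.1 hCV y).2 ⟨hy, h1⟩).1⟩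
  have hstrict : HasStrictFDerivAt h (fderiv ℝ h y₀) y₀ :=
    (hcd y₀ hy₀).hasStrictFDerivAt (by norm_num)
  have hrange : (fderiv ℝ h y₀).range = ⊤ := LinearMap.range_eq_top.2 hC.surjective
  let R := (fderiv ℝ h y₀).nonlinearRightInverseOfSurjective hrange
  have hR : 0 < (R.nnnorm : ℝ) :=
    (fderiv ℝ h y₀).nonlinearRightInverseOfSurjective_nnnorm_pos hrange
  -- Half of the surjectivity modulus is left for solving `h y' = k`, whence the constant `2`.
  obtain ⟨s, hs, happ⟩ := hstrict.approximates_deriv_on_nhds (c := R.nnnorm⁻¹ / 2)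
    (Or.inr (half_pos (inv_pos.2 hR)))
  obtain ⟨r, hr, hball⟩ := Metric.mem_nhds_iff.1 (inter_mem hs (hV.mem_nhds hy₀))
  have hev : ∀ᶠ y in 𝓝 y₀, y ∈ Metric.ball y₀ (r / 2) ∧ 2 * R.nnnorm * ‖h y‖ < r / 2 := by
    refine (eventually_mem_set.2 (Metric.ball_mem_nhds y₀ (half_pos hr))).and ?_
    have h1 : ContinuousAt (fun y => 2 * (R.nnnorm : ℝ) * ‖h y‖) y₀ :=
      continuousAt_const.mul hstrict.continuousAt.norm
    refine h1.eventually (gt_mem_nhds ?_)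
    change 2 * (R.nnnorm : ℝ) * ‖h y₀‖ < r / 2
    rw [hC.map_zero, norm_zero, mul_zero]
    exact half_pos hr
  obtain ⟨V', hV', hV'o, hy₀'⟩ := eventually_nhds_iff.1 hev
  have hsub : ∀ y ∈ V', y ∈ V := fun y hy =>
    (hball (Metric.ball_subset_ball (by linarith) (hV' y hy).1)).2
  refine ⟨2 * R.nnnorm, V', by positivity, hV'o, hy₀', fun y hy => hcd y (hsub y hy),
    fun y hy => hmem y (hsub y hy), fun y hy => ?_⟩
  obtain ⟨k, hk, hd⟩ := K.isClosed.exists_infDist_eq_dist K.nonempty (h y)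
  set d := Metric.infDist (h y) K with hd_def
  have hd0 : 0 ≤ d := Metric.infDist_nonneg
  have hdh : d ≤ ‖h y‖ := by
    simpa using Metric.infDist_le_dist_of_mem (x := h y)
      (show (0 : E) ∈ (K : Set E) from K.zero_mem)
  have hsmall : 2 * R.nnnorm * d < r / 2 :=
    lt_of_le_of_lt (mul_le_mul_of_nonneg_left hdh (by positivity)) (hV' y hy).2
  have hcb : Metric.closedBall y (2 * R.nnnorm * d) ⊆ s ∩ V := fun y' hy' => hball (by
    have h1 := dist_triangle y' y y₀
    have h2 : dist y y₀ < r / 2 := (hV' y hy).1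
    have h3 : dist y' y ≤ 2 * R.nnnorm * d := hy'
    rw [Metric.mem_ball]
    linarith)
  obtain ⟨y', hy', hky'⟩ := happ.surjOn_closedBall_of_nonlinearRightInverse R
    (by positivity) (hcb.trans inter_subset_left) (a := k) (by
      rw [Metric.mem_closedBall, dist_comm, ← hd]
      push_cast
      refine le_of_eq ?_
      field_simp
      ring)
  refine ⟨y', (hmem y' (hcb hy').2).2 (by rw [hky']; exact hk), ?_⟩
  rw [← dist_eq_norm]
  exact hy'

/-- Near `y₀` the set `C` is the preimage of `K` under `h`, so that the error bound gives its normal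
cone as the image of the polar cone under the adjoint of `∇h(y₀)`. -/
lemma IsC2ConeReduction.mem_normalCone_iff (hC : IsC2ConeReduction C y₀ h K)
    {lam : StrongDual ℝ Y} :
    lam ∈ normalCone C y₀ ↔ ∃ μ ∈ polarCone K, lam = μ.comp (fderiv ℝ h y₀) := by
  obtain ⟨c, V, hc, hV, hy₀, hcd, hmem, hbound⟩ := hC.exists_error_bound
  have hdiff : ∀ y ∈ V, DifferentiableAt ℝ h y :=
    fun y hy => (hcd y hy).differentiableAt (by norm_num)
  constructor
  · intro hlam
    obtain ⟨μ, h1, -, h2, -⟩ := exists_multiplier_of_mem_normalCone hc hV hy₀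
      (fun y hy => (hdiff y hy).differentiableWithinAt)
      (fun y hy => ((hcd y hy).fderiv_right (m := 1) (by norm_num)).continuousAt.continuousWithinAt)
      (fun y hy => (hmem y hy).1) hbound hlam
    exact ⟨μ, h1, h2.symm⟩
  · rintro ⟨μ, hμ, rfl⟩
    refine regularNormalCone_subset_normalCone _ _ (comp_mem_regularNormalCone
      (hdiff y₀ hy₀).hasFDerivAt hC.mem ?_ hμ (by rw [hC.map_zero]; exact _root_.map_zero μ))
    filter_upwards [hV.mem_nhds hy₀] with y hy using (hmem y hy).1

end Reducible

lemma adjointInv_comp {Y E : Type*} [NormedAddCommGroup Y] [NormedSpace ℝ Y]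
    [NormedAddCommGroup E] [NormedSpace ℝ E] {A : Y →L[ℝ] E} (hA : Function.Surjective A)
    (μ : StrongDual ℝ E) : adjointInv A (μ.comp A) = μ := by
  have hinj : Function.Injective fun μ : StrongDual ℝ E => μ.comp A := fun μ ν h => by
    refine ContinuousLinearMap.ext fun e => ?_
    obtain ⟨y, rfl⟩ := hA e
    exact congrArg (fun f => f y) h
  exact Function.leftInverse_invFun hinj μ

/-! ### The chain rule of second order -/

section ChainRule

variable {Z Y E F : Type*} [NormedAddCommGroup Z] [NormedSpace ℝ Z] [NormedAddCommGroup Y]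
  [NormedSpace ℝ Y] [NormedAddCommGroup E] [NormedSpace ℝ E] [NormedAddCommGroup F]
  [NormedSpace ℝ F]

lemma hasFDerivAt_fderiv {f : Z → F} {z₀ : Z} (hf : ContDiffAt ℝ 2 f z₀) :
    HasFDerivAt (fderiv ℝ f) (fderiv ℝ (fderiv ℝ f) z₀) z₀ :=
  ((hf.fderiv_right (m := 1) (by norm_num)).differentiableAt (by norm_num)).hasFDerivAt

lemma eventually_differentiableAt {f : Z → F} {z₀ : Z} (hf : ContDiffAt ℝ 2 f z₀) :
    ∀ᶠ z in 𝓝 z₀, DifferentiableAt ℝ f z :=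
  (hf.eventually (by norm_num)).mono fun _ hz => hz.differentiableAt (by norm_num)

lemma fderiv_fderiv_comp {g : Z → Y} {h : Y → E} {z₀ : Z} (hg : ContDiffAt ℝ 2 g z₀)
    (hh : ContDiffAt ℝ 2 h (g z₀)) (a b : Z) :
    fderiv ℝ (fderiv ℝ (h ∘ g)) z₀ a b =
      fderiv ℝ h (g z₀) (fderiv ℝ (fderiv ℝ g) z₀ a b) +
        fderiv ℝ (fderiv ℝ h) (g z₀) (fderiv ℝ g z₀ a) (fderiv ℝ g z₀ b) := by
  have h1 : fderiv ℝ (h ∘ g) =ᶠ[𝓝 z₀] fun z => (fderiv ℝ h (g z)).comp (fderiv ℝ g z) := by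
    filter_upwards [eventually_differentiableAt hg,
      hg.continuousAt.eventually (eventually_differentiableAt hh)] with z hz1 hz2
    exact fderiv_comp z hz2 hz1
  have h2 := (hasFDerivAt_fderiv hh).comp z₀ (hg.differentiableAt (by norm_num)).hasFDerivAt
  have h3 := (h2.clm_comp (hasFDerivAt_fderiv hg)).congr_of_eventuallyEq h1
  rw [h3.fderiv]
  simp

lemma fderiv_fderiv_clm_comp {h : Y → E} {y₀ : Y} (hh : ContDiffAt ℝ 2 h y₀) (μ : StrongDual ℝ E)
    (a b : Y) :
    fderiv ℝ (fderiv ℝ fun y => μ (h y)) y₀ a b = μ (fderiv ℝ (fderiv ℝ h) y₀ a b) := by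
  have h1 := fderiv_fderiv_comp (h := μ) hh μ.contDiff.contDiffAt a b
  have h2 : fderiv ℝ μ = fun _ => μ := funext fun y => μ.fderiv
  rw [h2] at h1
  simpa [Function.comp_def] using! h1

end ChainRule

/-! ### The constraint system -/

lemma reductionHessian_comp {Y E : Type*} [NormedAddCommGroup Y] [NormedSpace ℝ Y]
    [NormedAddCommGroup E] [InnerProductSpace ℝ E] {C : Set Y} {h : Y → E} {K : ProperCone ℝ E}
    {y₀ : Y} (hC : IsC2ConeReduction C y₀ h K) (μ : StrongDual ℝ E)
    (a b : Y) :
    reductionHessian h y₀ (μ.comp (fderiv ℝ h y₀)) a b = μ (fderiv ℝ (fderiv ℝ h) y₀ a b) := by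
  rw [reductionHessian, adjointInv_comp hC.surjective]
  exact fderiv_fderiv_clm_comp hC.contDiffAt μ a b

section System

variable {P X Y E : Type*} [NormedAddCommGroup P] [NormedSpace ℝ P]
  [NormedAddCommGroup X] [NormedSpace ℝ X]
  [NormedAddCommGroup Y] [NormedSpace ℝ Y]
  [NormedAddCommGroup E] [InnerProductSpace ℝ E]
  {g : P × X → Y} {C : Set Y} {h : Y → E} {K : ProperCone ℝ E} {z₀ : P × X}

lemma partialX_eq {f : P × X → Y} {z : P × X} (hf : DifferentiableAt ℝ f z) :
    partialX f z = (fderiv ℝ f z).comp (ContinuousLinearMap.inr ℝ P X) :=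
  (HasFDerivAt.comp z.2 (f := fun x => (z.1, x)) hf.hasFDerivAt
    (hasFDerivAt_prodMk_right _ _)).fderiv

lemma partialP_eq {f : P × X → Y} {z : P × X} (hf : DifferentiableAt ℝ f z) :
    partialP f z = (fderiv ℝ f z).comp (ContinuousLinearMap.inl ℝ P X) :=
  (HasFDerivAt.comp z.1 (f := fun p => (p, z.2)) hf.hasFDerivAt
    (hasFDerivAt_prodMk_left _ _)).fderiv

lemma fderiv_comp_partialX (hg : ContDiffAt ℝ 2 g z₀) (lam : StrongDual ℝ Y) (v : P × X) :
    fderiv ℝ (fun z => (lam.comp (partialX g z) : StrongDual ℝ X)) z₀ v =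
      (lam.comp (fderiv ℝ (fderiv ℝ g) z₀ v)).comp (ContinuousLinearMap.inr ℝ P X) := by
  have h1 : (fun z => (lam.comp (partialX g z) : StrongDual ℝ X)) =ᶠ[𝓝 z₀]
      fun z => lam.comp ((fderiv ℝ g z).comp (ContinuousLinearMap.inr ℝ P X)) := by
    filter_upwards [eventually_differentiableAt hg] with z hz
    rw [partialX_eq hz]
  have h2 := (hasFDerivAt_const lam z₀).clm_comp ((hasFDerivAt_fderiv hg).clm_comp
    (hasFDerivAt_const (ContinuousLinearMap.inr ℝ P X) z₀))
  rw [(h2.congr_of_eventuallyEq h1).fderiv]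
  refine ContinuousLinearMap.ext fun x => ?_
  simp

lemma multiplierObjective_comp (hg : ContDiffAt ℝ 2 g z₀) (hC : IsC2ConeReduction C (g z₀) h K)
    (μ : StrongDual ℝ E) (v : P × X) :
    multiplierObjective g h z₀ v (μ.comp (fderiv ℝ h (g z₀))) =
      μ (fderiv ℝ (fderiv ℝ (h ∘ g)) z₀ v v) := by
  rw [multiplierObjective, reductionHessian_comp hC, fderiv_fderiv_comp hg hC.contDiffAt, map_add]
  rfl

lemma fderiv_add_curvatureTerm_comp (hg : ContDiffAt ℝ 2 g z₀)
    (hC : IsC2ConeReduction C (g z₀) h K) (μ : StrongDual ℝ E) (v : P × X) :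
    fderiv ℝ (fun z => ((μ.comp (fderiv ℝ h (g z₀))).comp (partialX g z) : StrongDual ℝ X)) z₀ v +
        curvatureTerm g h z₀ (μ.comp (fderiv ℝ h (g z₀))) v =
      (μ.comp (fderiv ℝ (fderiv ℝ (h ∘ g)) z₀ v)).comp (ContinuousLinearMap.inr ℝ P X) := by
  refine ContinuousLinearMap.ext fun x => ?_
  rw [fderiv_comp_partialX hg, curvatureTerm, partialX_eq (hg.differentiableAt (by norm_num))]
  simp only [add_apply, ContinuousLinearMap.comp_apply, reductionHessian_comp hC,
    fderiv_fderiv_comp hg hC.contDiffAt, map_add]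

/-- Robinson stability and the metric regularity of the reduction make `G = h ∘ g` a stable
reduction of the graph of the solution map. -/
theorem exists_isStableReduction [FiniteDimensional ℝ Y] [FiniteDimensional ℝ E]
    (hg : ContDiffAt ℝ 2 g z₀) (hC : IsC2ConeReduction C (g z₀) h K)
    (hRS : RobinsonStable g C z₀.1 z₀.2) :
    ∃ κ U, IsStableReduction (gph (solMap g C)) (h ∘ g) K z₀ κ U := by
  obtain ⟨c, V, hc, hV, hy₀, hcd, hmem, hbound⟩ := hC.exists_error_bound
  obtain ⟨κ, Ux, hUx, W, hW, hκ⟩ := hRS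
  have hev : ∀ᶠ z in 𝓝 z₀, ContDiffAt ℝ 2 g z ∧ g z ∈ V ∧ z.1 ∈ W ∧ z.2 ∈ Ux :=
    (hg.eventually (by norm_num)).and ((hg.continuousAt.eventually (hV.mem_nhds hy₀)).and
      (((continuous_fst.tendsto z₀).eventually hW).and
        ((continuous_snd.tendsto z₀).eventually hUx)))
  obtain ⟨U, hU, hUo, hz₀⟩ := eventually_nhds_iff.1 hev
  have hmem' : ∀ z ∈ U, (z ∈ gph (solMap g C) ↔ (h ∘ g) z ∈ K) := fun z hz =>
    hmem (g z) (hU z hz).2.1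
  -- The summand `1` leaves room to choose a point that attains the bound, since the distance to the
  -- section is an infimum.
  refine ⟨κ * c + 1, U,
    { nonneg := by positivity
      isOpen := hUo
      mem := hz₀
      contDiffAt := fun z hz => (hcd _ (hU z hz).2.1).comp z (hU z hz).1
      map_zero := hC.map_zero
      mem_iff := hmem'
      error_bound := fun z hz => ?_ }⟩
  by_cases hzK : (h ∘ g) z ∈ K
  · refine ⟨z.2, (hmem' z hz).2 hzK, ?_⟩
    rw [sub_self, norm_zero]
    exact mul_nonneg (by positivity) Metric.infDist_nonneg
  · have hd : 0 < Metric.infDist ((h ∘ g) z) K :=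
      (K.isClosed.notMem_iff_infDist_pos K.nonempty).1 hzK
    set d := Metric.infDist ((h ∘ g) z) K with hd_def
    obtain ⟨y', hy', hn⟩ := hbound (g z) (hU z hz).2.1
    have h1 : Metric.infEDist (g z) C ≤ ENNReal.ofReal (c * d) := by
      refine (Metric.infEDist_le_edist_of_mem hy').trans ?_
      rw [edist_dist, dist_comm, dist_eq_norm]
      exact ENNReal.ofReal_le_ofReal hn
    have h2 : Metric.infEDist z.2 (solMap g C z.1) < ENNReal.ofReal ((κ * c + 1) * d) := by
      refine lt_of_le_of_lt ((hκ z.1 (hU z hz).2.2.1 z.2 (hU z hz).2.2.2).trans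
        (mul_le_mul_right h1 _)) ?_
      rw [← ENNReal.ofReal_coe_nnreal, ← ENNReal.ofReal_mul κ.coe_nonneg]
      refine (ENNReal.ofReal_lt_ofReal_iff (by positivity)).2 ?_
      linarith
    obtain ⟨x', hx', hlt⟩ := Metric.infEDist_lt_iff.1 h2
    refine ⟨x', hx', ?_⟩
    rw [edist_dist, ENNReal.ofReal_lt_ofReal_iff (by positivity)] at hlt
    rw [← dist_eq_norm, dist_comm]
    exact hlt.le

/-- If the characteristic subspace is everything, then `∇_p G` factors through `∇_x G` modulo the
lineality space of `K`. -/
lemma exists_clm_of_characteristicSubspace_eq_top [FiniteDimensional ℝ P] {Y : Type*}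
    {g : P × X → Y} {h : Y → E} (hG : DifferentiableAt ℝ (h ∘ g) z₀)
    (hP : characteristicSubspace g h K z₀ = ⊤) :
    ∃ L : P →L[ℝ] X, ∀ q, fderiv ℝ (h ∘ g) z₀ (q, 0) - fderiv ℝ (h ∘ g) z₀ (0, L q) ∈ K ∧
      -(fderiv ℝ (h ∘ g) z₀ (q, 0) - fderiv ℝ (h ∘ g) z₀ (0, L q)) ∈ K := by
  set N := K.toPointedCone.lineal with hN
  let Bx : X →ₗ[ℝ] E ⧸ N := N.mkQ ∘ₗ (partialX (h ∘ g) z₀ : X →ₗ[ℝ] E)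
  let Bp : P →ₗ[ℝ] E ⧸ N := N.mkQ ∘ₗ (partialP (h ∘ g) z₀ : P →ₗ[ℝ] E)
  have hrange : ∀ q, Bp q ∈ LinearMap.range Bx := by
    intro q
    have hq : q ∈ characteristicSubspace g h K z₀ := by rw [hP]; trivial
    obtain ⟨_, ⟨x, rfl⟩, l, hl, hsum⟩ := Submodule.mem_sup.1 (Submodule.mem_comap.1 hq)
    refine ⟨x, ?_⟩
    have h1 := congrArg N.mkQ hsum
    have h2 : N.mkQ l = 0 := (Submodule.Quotient.mk_eq_zero N).2 hl
    rw [map_add, h2, add_zero] at h1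
    exact h1
  obtain ⟨L, hL⟩ := Module.projective_lifting_property Bx.rangeRestrict
    (Bp.codRestrict (LinearMap.range Bx) hrange) Bx.surjective_rangeRestrict
  refine ⟨LinearMap.toContinuousLinearMap L, fun q => ?_⟩
  have h1 : Bx (L q) = Bp q := congrArg Subtype.val (LinearMap.congr_fun hL q)
  have h2 : partialP (h ∘ g) z₀ q - partialX (h ∘ g) z₀ (L q) ∈ N :=
    (Submodule.Quotient.eq N).1 h1.symm
  rw [partialP_eq hG, partialX_eq hG] at h2
  exact h2

end System

/-! ### The tangent cone to the graph of the normal cone mapping -/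

section Graph

variable {P X Y E : Type*} [NormedAddCommGroup P] [NormedSpace ℝ P]
  [NormedAddCommGroup X] [NormedSpace ℝ X]
  [NormedAddCommGroup Y] [NormedSpace ℝ Y] [FiniteDimensional ℝ Y]
  [NormedAddCommGroup E] [InnerProductSpace ℝ E] [FiniteDimensional ℝ E]
  {g : P × X → Y} {C : Set Y} {h : Y → E} {K : ProperCone ℝ E} {z₀ : P × X} {xs : StrongDual ℝ X}

/-- Under Robinson stability the tangent vectors to the graph of the normal cone mapping
are the reduced tangents; the alternative on `K` enters only in the inclusion from left to right. -/
theorem mem_tangentCone_gph_iff [FiniteDimensional ℝ P] [FiniteDimensional ℝ X]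
    (hg : ContDiffAt ℝ 2 g z₀)
    (hC : IsC2ConeReduction C (g z₀) h K) (hRS : RobinsonStable g C z₀.1 z₀.2)
    (hPK : characteristicSubspace g h K z₀ = ⊤ ∨ IsPolyhedralCone K)
    (v : P × X) (us : StrongDual ℝ X) :
    (v, us) ∈ tangentCone (gph (normalConeMap g C)) (z₀, xs) ↔
      ∃ μ ws, IsReducedTangent (h ∘ g) K z₀ xs v us μ ws := by
  obtain ⟨κ, U, M⟩ := exists_isStableReduction hg hC hRS
  constructor
  · rintro ⟨t, wk, ht, ht0, hwk, hk⟩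
    obtain ⟨t, w, u, m, μ, Q⟩ := exists_isMultiplierSequence M (v := v) (us := us) (xs := xs)
      (w := fun k => (wk k).1) (u := fun k => (wk k).2) ht ht0
      ((continuous_fst.tendsto _).comp hwk) ((continuous_snd.tendsto _).comp hwk) hk
    refine ⟨μ, ?_⟩
    rcases hPK with hP | hK
    · obtain ⟨L, hL⟩ := exists_clm_of_characteristicSubspace_eq_top
        (M.hasFDerivAt M.mem).differentiableAt hP
      exact Q.exists_isReducedTangent_of_characteristic M L hL
    · exact Q.exists_isReducedTangent_of_polyhedral M hK
  · rintro ⟨μ, ws, H⟩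
    obtain ⟨t, w, u, ht, ht0, hw, hu, hk⟩ := exists_sequence_of_isReducedTangent M H
    exact ⟨t, fun k => (w k, u k), ht, ht0, hw.prodMk_nhds hu, hk⟩

/-- Multipliers of the system `g z ∈ C` correspond to multipliers of the reduced system, and the
normal cones to the tangent and critical cones of the graph are polars. -/
theorem exists_isReducedTangent_iff (hg : ContDiffAt ℝ 2 g z₀)
    (hC : IsC2ConeReduction C (g z₀) h K) (hRS : RobinsonStable g C z₀.1 z₀.2)
    (v : P × X) (us : StrongDual ℝ X) :
    (∃ μ ws, IsReducedTangent (h ∘ g) K z₀ xs v us μ ws) ↔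
      ∃ zs ∈ normalCone (tangentCone (gph (solMap g C)) z₀) v ∩ projX ⁻¹' {xs},
        ∃ lam ∈ directionalMultipliers g C h z₀ zs v, us ∈ derivativeSet g C h z₀ zs lam v := by
  obtain ⟨κ, U, M⟩ := exists_isStableReduction hg hC hRS
  set A := fderiv ℝ (h ∘ g) z₀ with hA
  have hAcomp : A = (fderiv ℝ h (g z₀)).comp (fderiv ℝ g z₀) :=
    fderiv_comp z₀ (hC.contDiffAt.differentiableAt (by norm_num))
      (hg.differentiableAt (by norm_num))
  have hT : tangentCone (gph (solMap g C)) z₀ = {w | A w ∈ K} := M.tangentCone_eq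
  have hTconv : Convex ℝ {w | A w ∈ K} := K.convex.linear_preimage A.toLinearMap
  have hTsmul : ∀ w ∈ {w | A w ∈ K}, ∀ s : ℝ, 0 ≤ s → s • w ∈ {w | A w ∈ K} := by
    intro w hw s hs
    rw [mem_ofPred_eq, map_smul]
    exact K.smul_mem hw hs
  have hcrit : ∀ zs : StrongDual ℝ (P × X), ∀ ws : StrongDual ℝ (P × X),
      ws ∈ normalCone (criticalCone (gph (solMap g C)) z₀ zs) v ↔
        (A v ∈ K ∧ zs v = 0) ∧ (∀ w, A w ∈ K ∧ zs w = 0 → ws w ≤ 0) ∧ ws v = 0 := by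
    intro zs ws
    rw [criticalCone, hT]
    refine mem_normalCone_of_convexCone (hTconv.inter ?_) ?_
    · exact (convex_singleton (0 : ℝ)).linear_preimage zs.toLinearMap
    · rintro w ⟨hw, hw0⟩ s hs
      refine ⟨hTsmul w hw s hs, ?_⟩
      rw [mem_ofPred_eq, map_smul, show zs w = 0 from hw0, smul_zero]
  rw [hT]
  have hmult : ∀ lam zs, lam ∈ multipliers g C z₀ zs ↔
      ∃ μ ∈ polarCone K, lam = μ.comp (fderiv ℝ h (g z₀)) ∧ μ.comp A = zs := by
    intro lam zs
    rw [multipliers, mem_ofPred_eq, hC.mem_normalCone_iff]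
    constructor
    · rintro ⟨⟨μ, hμ, rfl⟩, h2⟩
      exact ⟨μ, hμ, rfl, by rw [hAcomp, ← ContinuousLinearMap.comp_assoc, h2]⟩
    · rintro ⟨μ, hμ, rfl, h2⟩
      exact ⟨⟨μ, hμ, rfl⟩, by rw [← h2, hAcomp, ContinuousLinearMap.comp_assoc]⟩
  constructor
  · rintro ⟨μ, ws, H⟩
    refine ⟨μ.comp A, ⟨(mem_normalCone_of_convexCone hTconv hTsmul).2
      ⟨H.mem, fun w hw => H.polar _ hw, H.apply_eq_zero⟩, ?_⟩,
      μ.comp (fderiv ℝ h (g z₀)), ⟨(hmult _ _).2 ⟨μ, H.polar, rfl, rfl⟩, ?_⟩, ws, ?_, ?_⟩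
    · exact H.comp_eq
    · intro lam' hlam'
      obtain ⟨μ', hμ', rfl, hcomp⟩ := (hmult _ _).1 hlam'
      rw [multiplierObjective_comp hg hC, multiplierObjective_comp hg hC]
      exact H.maximal μ' hμ' hcomp
    · exact (hcrit _ _).2 ⟨⟨H.mem, H.apply_eq_zero⟩, fun w hw => H.normal_nonpos w hw.1 hw.2,
        H.normal_apply⟩
    · rw [fderiv_add_curvatureTerm_comp hg hC]
      exact H.eq
  · rintro ⟨zs, ⟨hzs, hproj⟩, lam, ⟨hlam, hmax⟩, ws, hws, heq⟩
    obtain ⟨μ, hμ, rfl, rfl⟩ := (hmult _ _).1 hlam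
    obtain ⟨⟨hv, hv0⟩, hpos, hwv⟩ := (hcrit _ _).1 hws
    rw [fderiv_add_curvatureTerm_comp hg hC] at heq
    refine ⟨μ, ws,
      { mem := hv
        polar := hμ
        apply_eq_zero := hv0
        comp_eq := hproj
        maximal := fun μ' hμ' hcomp => ?_
        normal_nonpos := fun w h1 h2 => hpos w ⟨h1, h2⟩
        normal_apply := hwv
        eq := heq }⟩
    have := hmax _ ((hmult _ _).2 ⟨μ', hμ', rfl, hcomp⟩)
    rwa [multiplierObjective_comp hg hC, multiplierObjective_comp hg hC] at this

end Graph

end VarAnalysis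
end

open VarAnalysis
theorem mainTheorem1 {P X Y E : Type*}
    [NormedAddCommGroup P] [InnerProductSpace ℝ P] [FiniteDimensional ℝ P]
    [NormedAddCommGroup X] [InnerProductSpace ℝ X] [FiniteDimensional ℝ X]
    [NormedAddCommGroup Y] [InnerProductSpace ℝ Y] [FiniteDimensional ℝ Y]
    [NormedAddCommGroup E] [InnerProductSpace ℝ E] [FiniteDimensional ℝ E]
    (g : P × X → Y) (C : Set Y) (h : Y → E) (K : ProperCone ℝ E)
    (p₀ : P) (x₀ : X) (xs : StrongDual ℝ X)
    (hg : ContDiffAt ℝ 2 g (p₀, x₀))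
    (hC : IsC2ConeReduction C (g (p₀, x₀)) h K)
    (hxs : xs ∈ normalConeMap g C (p₀, x₀))
    (hRS : RobinsonStable g C p₀ x₀)
    (hPK : characteristicSubspace g h K (p₀, x₀) = ⊤ ∨ IsPolyhedralCone K) :
    tangentCone (gph (normalConeMap g C)) ((p₀, x₀), xs) =
      {a : (P × X) × StrongDual ℝ X |
        ∃ zs ∈ normalCone (tangentCone (gph (solMap g C)) (p₀, x₀)) a.1 ∩ projX ⁻¹' {xs},
          ∃ lam ∈ directionalMultipliers g C h (p₀, x₀) zs a.1,
            a.2 ∈ derivativeSet g C h (p₀, x₀) zs lam a.1} ∧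
    ∀ v : P × X,
      graphicalDerivative (normalConeMap g C) (p₀, x₀) xs v =
        ⋃ zs ∈ normalCone (tangentCone (gph (solMap g C)) (p₀, x₀)) v ∩ projX ⁻¹' {xs},
          ⋃ lam ∈ directionalMultipliers g C h (p₀, x₀) zs v,
            derivativeSet g C h (p₀, x₀) zs lam v := by
  have key : ∀ v us, (v, us) ∈ tangentCone (gph (normalConeMap g C)) ((p₀, x₀), xs) ↔
      ∃ zs ∈ normalCone (tangentCone (gph (solMap g C)) (p₀, x₀)) v ∩ projX ⁻¹' {xs},
        ∃ lam ∈ directionalMultipliers g C h (p₀, x₀) zs v,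
          us ∈ derivativeSet g C h (p₀, x₀) zs lam v := fun v us =>
    (mem_tangentCone_gph_iff hg hC hRS hPK v us).trans (exists_isReducedTangent_iff hg hC hRS v us)
  refine ⟨Set.ext fun a => key a.1 a.2, fun v => Set.ext fun us => ?_⟩
  simp only [Set.mem_iUnion, exists_prop]
  exact key v us
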